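/- Let $\mathfrak g\neq 0$ be a semisimple Lie algebra over an algebraically closed field $F$ of characteristic $0$, and let $G$ be a connected semisimple algebraic group with Lie algebra $\mathfrak g$. Let $\mathfrak s^{\mathrm{pr}}\subset\mathfrak g$ be a principal $\mathfrak{sl}_2$-subalgebra, i.e. one spanned by an $\mathfrak{sl}_2$-triple $(h,e,f)$ whose nilpotent element $e$ has a centralizer in $\mathfrak g$ of dimension $\operatorname{rk}\mathfrak g$, and let $S^{\mathrm{pr}}\subset G$ be the corresponding connected subgroup, the image of a homomorphism $SL_2\to G$. For a positive integer $m$ let $s_m\in S^{\mathrm{pr}}$ be the image of $\operatorname{diag}(\varepsilon_{2m},\varepsilon_{2m}^{-1})$, where $\varepsilon_{2m}\in F$ is a primitive $2m$-th root of unity, let $\sigma_m=\mathrm{Ad}(s_m)$, and set $d(m)=\dim\mathfrak g^{\sigma_m}$, the dimension of the fixed-point subalgebra of $\sigma_m$ (it does not depend on the choice of $\varepsilon_{2m}$). The Coxeter number of a simple Lie algebra is the order of a Coxeter element of its Weyl group, and $h(\mathfrak g)$ denotes the maximum of the Coxeter numbers of the simple ideals of $\mathfrak g$. **Proposition 2.2.**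 Let $m$ and $m'$ be positive integers. If $m'<m$, then $d(m')\ge d(m)$. Moreover, if $m'$ divides $m$, $m'\ne m$ and $m<h(\mathfrak g)$, then $d(m')>d(m)$. -/

import Mathlib

namespace PrincipalAutomorphism

section Principal

variable (F : Type*) [Field F] {L : Type*} [LieRing L] [LieAlgebra F L]

/-- `(h, e, f)` is the standard basis of a principal `sl₂`-subalgebra: it is an `sl₂`-triple and the
nilpotent element `e` is principal (regular), i.e. the dimension of its centralizer
`{x | ⁅e, x⁆ = 0}` equals the rank of the Lie algebra. -/
structure IsPrincipalSl2Triple [FiniteDimensional F L] (h e f : L) : Prop where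
  isSl2Triple : IsSl2Triple h e f
  finrank_centralizer :
    Module.finrank F (LinearMap.ker (LieAlgebra.ad F L e : Module.End F L)) = LieAlgebra.rank F L

/-- `exp (ad x)` for an ad-nilpotent element `x` of a finite-dimensional Lie algebra `L` over a field
of characteristic zero: the powers of a nilpotent endomorphism vanish from the exponent `dim L` on,
so this is the whole exponential series. -/
noncomputable def expAd (x : L) : Module.End F L :=
  ∑ k ∈ Finset.range (Module.finrank F L),
    (k.factorial : F)⁻¹ • (LieAlgebra.ad F L x : Module.End F L) ^ k

variable {F}

/-- The action on `L` of the matrix `!![0, t; -t⁻¹, 0]` of `SL₂(F)` through the adjoint action of the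
connected subgroup with Lie algebra spanned by the `sl₂`-triple `(h, e, f)`. In `SL₂(F)` one has
`!![0, t; -t⁻¹, 0] = !![1, t; 0, 1] * !![1, 0; -t⁻¹, 1] * !![1, t; 0, 1]`, where `!![1, t; 0, 1]`
acts as `exp (ad (t e))` and `!![1, 0; u, 1]` acts as `exp (ad (u f))`. -/
noncomputable def weylAd (e f : L) (t : F) : Module.End F L :=
  expAd F (t • e) * expAd F (-t⁻¹ • f) * expAd F (t • e)

/-- The action on `L` of the matrix `diag(t, t⁻¹)` of `SL₂(F)` through the adjoint action of the
connected subgroup with Lie algebra spanned by the `sl₂`-triple `(h, e, f)`. In `SL₂(F)` one has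
`diag(t, t⁻¹) = !![0, t; -t⁻¹, 0] * !![0, -1; 1, 0]`. For a principal triple and a primitive `2m`-th
root of unity `t` this is the principal automorphism of order `m`. -/
noncomputable def torusAd (e f : L) (t : F) : Module.End F L :=
  weylAd e f t * weylAd e f (-1)

/-- The dimension of the space of fixed points of the action of `diag(t, t⁻¹)` on `L`. For a
principal triple and a primitive `2m`-th root of unity `t` this is the number `d(m)`. -/
noncomputable def fixedDim (e f : L) (t : F) : ℕ :=
  Module.finrank F (LinearMap.eqLocus (torusAd e f t) (1 : Module.End F L))

end Principal

section Coxeter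

/-- `w` is a Coxeter element of the Weyl group of the root pairing `P` (acting on the space spanned by
the roots): the product, in some order, of the reflections in the simple roots of some base. -/
def IsCoxeterElement {ι R M N : Type*} [CommRing R] [AddCommGroup M] [Module R M]
    [AddCommGroup N] [Module R N] (P : RootPairing ι R M N) (w : M ≃ₗ[R] M) : Prop :=
  ∃ (b : P.Base) (l : List ι), l.Nodup ∧ (∀ i, i ∈ l ↔ i ∈ b.support) ∧
    w = (l.map P.reflection).prod

variable (F : Type*) [Field F] [IsAlgClosed F] [CharZero F]
  (L : Type*) [LieRing L] [LieAlgebra F L] [FiniteDimensional F L]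

/-- The Coxeter number of a simple Lie algebra: the order of a Coxeter element of its Weyl group.
All Cartan subalgebras are conjugate and so are all Coxeter elements, hence the set of orders has
exactly one element, which `sInf` selects. -/
noncomputable def simpleCoxeterNumber [LieAlgebra.IsSimple F L] : ℕ :=
  sInf {n | ∃ (H : LieSubalgebra F L) (_ : H.IsCartanSubalgebra)
    (w : Module.Dual F H ≃ₗ[F] Module.Dual F H),
    IsCoxeterElement (LieAlgebra.IsKilling.rootSystem H) w ∧ n = orderOf w}

/-- The Coxeter number of a semisimple Lie algebra: the maximum of the Coxeter numbers of its
(finitely many) simple ideals, and `1` for the zero Lie algebra. -/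
noncomputable def coxeterNumber : ℕ :=
  sSup ({1} ∪ {n | ∃ (I : LieIdeal F L) (_ : LieAlgebra.IsSimple F I),
    n = simpleCoxeterNumber F I})

end Coxeter

end PrincipalAutomorphism

/-! Let `L_j` be the eigenspace of `ad h` for the eigenvalue `2j`. An `sl₂`-module has at least as
many irreducible constituents as the weights 0 and 1 have multiplicity together. For a principal
triple the centralizer of `e` has dimension `rk L`, while the Engel subalgebra of `h` has dimension
at least `rk L`. Hence weight 1 does not occur, all weights are even, and `L_0` is a Cartan
subalgebra (`finrank_maxGenEigenspace_one`, `isCartanSubalgebra_engel`); so `ad h` is semisimple and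
`L` is the sum of the `L_j`. Since `diag(t, t⁻¹)` acts on `L_j` by `t ^ (2j)`, `d(m)` is the sum
over `i` of `dim L_{mi}` (`fixedDim_eq_sum`). These dimensions do not increase away from degree 0,
and comparing the sums term by term gives the inequality.

If `m'` properly divides `m`, the fixed space for `m` lies in the one for `m'`, and a nonzero
`L_{m'}` makes the inclusion strict. Suppose `L_{m'} = 0` with `m' = n + 1`. Only degrees from `-n`
to `n` occur, so a simple ideal `I` of rank `r` has `dim I ≤ (2n + 1) r`. The root decomposition
gives `dim I = r + |Φ|`, and `r` times the Coxeter number is at most `|Φ|`. So all Coxeter numbers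
are at most `2n < 2m' ≤ m`, against `m < h(L)`.

The bound on `|Φ|` is `exists_list_card_mul_orderOf_le`, proved with a bipartite Coxeter element. A
Perron–Frobenius eigenvector gives a map from the roots to a plane on which this element acts as a
product of two reflections. The simple roots, with suitable signs, then have distinct orbits of full
length. -/

namespace Matrix

/-! ### Positive eigenvectors and two-colourings of Cartan matrices. -/

open scoped RealInnerProductSpace in
/-- A symmetric real matrix with nonnegative entries and connected support has an eigenvector with
positive coordinates. -/
lemma exists_pos_mulVec_eq_smul_of_isSymm {I : Type*} [Fintype I] [Nonempty I]
    (S : Matrix I I ℝ) (hS : S.IsSymm) (hnonneg : ∀ i j, 0 ≤ S i j)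
    (hconn : ∀ (p : I → Prop) (i j : I), p i → (∀ i j, p i → S j i ≠ 0 → p j) → p j) :
    ∃ (c : ℝ) (y : I → ℝ), (∀ i, 0 < y i) ∧ S *ᵥ y = c • y := by
  classical
  let T : EuclideanSpace ℝ I →L[ℝ] EuclideanSpace ℝ I := Matrix.toEuclideanCLM (𝕜 := ℝ) S
  have hTapp (x : EuclideanSpace ℝ I) (i : I) : T x i = ∑ j, S i j * x j := by
    simp [T, Matrix.mulVec, dotProduct]
  have hQ (x : EuclideanSpace ℝ I) :
      T.reApplyInnerSelf x = ∑ i, ∑ j, S i j * (x i * x j) := by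
    simp only [ContinuousLinearMap.reApplyInnerSelf_apply, PiLp.inner_apply, hTapp]
    simp only [RCLike.inner_apply, conj_trivial, Finset.mul_sum, RCLike.re_to_real]
    exact Finset.sum_congr rfl fun i _ ↦ Finset.sum_congr rfl fun j _ ↦ by ring
  have hT : IsSelfAdjoint T := by
    rw [ContinuousLinearMap.isSelfAdjoint_iff_isSymmetric]
    intro x y
    simp only [ContinuousLinearMap.coe_coe, PiLp.inner_apply, hTapp]
    simp only [RCLike.inner_apply, conj_trivial, Finset.mul_sum, Finset.sum_mul]
    rw [Finset.sum_comm]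
    refine Finset.sum_congr rfl fun i _ ↦ Finset.sum_congr rfl fun j _ ↦ ?_
    rw [← hS.apply i j]
    ring
  -- Maximize the quadratic form on the unit sphere. Since the entries are nonnegative, replacing
  -- the coordinates by their absolute values does not lower it, so a nonnegative vector is a
  -- maximizer, hence an eigenvector.
  obtain ⟨x₀, hx₀, hmax⟩ := (isCompact_sphere (0 : EuclideanSpace ℝ I) 1).exists_isMaxOn
    (NormedSpace.sphere_nonempty.mpr zero_le_one) T.reApplyInnerSelf_continuous.continuousOn
  let x : EuclideanSpace ℝ I := WithLp.toLp 2 fun i ↦ |x₀ i|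
  have hxnorm : ‖x‖ = 1 := by
    have : ‖x₀‖ = 1 := by simpa using hx₀
    rw [← this, EuclideanSpace.norm_eq, EuclideanSpace.norm_eq]
    simp [x]
  have hxne : x ≠ 0 := by
    rintro h
    simp [h] at hxnorm
  have hQx : T.reApplyInnerSelf x₀ ≤ T.reApplyInnerSelf x := by
    rw [hQ, hQ]
    refine Finset.sum_le_sum fun i _ ↦ Finset.sum_le_sum fun j _ ↦
      mul_le_mul_of_nonneg_left ?_ (hnonneg i j)
    simp only [x, ← abs_mul]
    exact le_abs_self _
  have hmax' : IsMaxOn T.reApplyInnerSelf (Metric.sphere 0 ‖x‖) x := by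
    rw [hxnorm]
    exact fun z hz ↦ (hmax hz).trans hQx
  have heig := (hT.hasEigenvector_of_isMaxOn hxne hmax').apply_eq_smul
  set c : ℝ := ⨆ x : { x : EuclideanSpace ℝ I // x ≠ 0 }, T.rayleighQuotient x
  have heig' (i : I) : ∑ j, S i j * x j = c * x i := by
    have := congrArg (fun z : EuclideanSpace ℝ I ↦ z i) heig
    simp only [ContinuousLinearMap.coe_coe, hTapp] at this
    simpa using this
  have hx_nonneg (i : I) : 0 ≤ x i := by simp [x]
  refine ⟨c, x, fun i ↦ (hx_nonneg i).lt_of_ne' fun hi ↦ hxne ?_, funext fun i ↦ by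
    simpa [Matrix.mulVec, dotProduct] using heig' i⟩
  ext j
  -- At a zero coordinate the eigenvalue equation is a vanishing sum of nonnegative terms, so the
  -- neighbouring coordinates vanish too.
  refine hconn (fun k ↦ x k = 0) i j hi fun k l hk hlk ↦ ?_
  have h0 : ∑ j, S k j * x j = 0 := by rw [heig', hk, mul_zero]
  rw [Finset.sum_eq_zero_iff_of_nonneg fun j _ ↦ mul_nonneg (hnonneg k j) (hx_nonneg j)] at h0
  have := h0 l (Finset.mem_univ l)
  rw [hS.apply] at this
  exact (mul_eq_zero.mp this).resolve_left hlk

/-- A nonnegative, connected matrix which is symmetrizable by a positive diagonal matrix has an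
eigenvector with positive coordinates. -/
lemma exists_pos_mulVec_eq_smul {I : Type*} [Fintype I] [Nonempty I]
    (N : Matrix I I ℝ) (d : I → ℝ) (hd : ∀ i, 0 < d i) (hN : ∀ i j, N i j * d j = N j i * d i)
    (hnonneg : ∀ i j, 0 ≤ N i j)
    (hconn : ∀ (p : I → Prop) (i j : I), p i → (∀ i j, p i → N j i ≠ 0 → p j) → p j) :
    ∃ (c : ℝ) (y : I → ℝ), (∀ i, 0 < y i) ∧ N *ᵥ y = c • y := by
  have hs (i : I) : 0 < √(d i) := Real.sqrt_pos.mpr (hd i)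
  have hss (i : I) : √(d i) * √(d i) = d i := Real.mul_self_sqrt (hd i).le
  -- Conjugation by the square root of the diagonal matrix symmetrizes `N` and keeps its signs and
  -- support.
  let S : Matrix I I ℝ := Matrix.of fun i j ↦ N i j * √(d j) / √(d i)
  have hS0 (i j : I) : S i j = N i j * √(d j) / √(d i) := rfl
  obtain ⟨c, z, hz, hSz⟩ := exists_pos_mulVec_eq_smul_of_isSymm S
    (by
      ext i j
      rw [Matrix.transpose_apply, hS0, hS0, div_eq_div_iff (hs j).ne' (hs i).ne', mul_assoc,
        mul_assoc, hss, hss, hN])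
    (fun i j ↦ div_nonneg (mul_nonneg (hnonneg i j) (hs j).le) (hs i).le)
    (fun p i j hi hp ↦ hconn p i j hi fun k l hk hlk ↦ hp k l hk <| by
      rw [hS0]
      exact div_ne_zero (mul_ne_zero hlk (hs k).ne') (hs l).ne')
  refine ⟨c, fun j ↦ √(d j) * z j, fun j ↦ mul_pos (hs j) (hz j), funext fun i ↦ ?_⟩
  have := congrFun hSz i
  simp only [Matrix.mulVec, dotProduct, Pi.smul_apply, smul_eq_mul, hS0] at this ⊢
  rw [mul_left_comm, ← this, Finset.mul_sum]
  refine Finset.sum_congr rfl fun j _ ↦ ?_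
  have := (hs i).ne'
  field_simp

/-- The graph of a generalized Cartan matrix of finite type is bipartite. -/
lemma exists_coloring_of_posDef_mul_diagonal {I : Type*} [Fintype I] [DecidableEq I]
    (A : Matrix I I ℤ) (d : I → ℤ) (hd : ∀ i, 0 < d i) (hA : (A * diagonal d).PosDef)
    (hdiag : ∀ i, A i i = 2) (hle : ∀ i j, i ≠ j → A i j ≤ 0)
    (hsymm : ∀ i j, A i j = 0 ↔ A j i = 0) :
    ∃ c : I → Bool, ∀ i j, i ≠ j → A i j ≠ 0 → c i ≠ c j := by
  suffices ∀ s : Finset I, ∃ c : I → Bool, ∀ i ∈ s, ∀ j ∈ s, i ≠ j → A i j ≠ 0 → c i ≠ c j by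
    obtain ⟨c, hc⟩ := this Finset.univ
    exact ⟨c, fun i j ↦ hc i (Finset.mem_univ i) j (Finset.mem_univ j)⟩
  intro s
  induction s using Finset.strongInduction with
  | H s ih =>
    rcases s.eq_empty_or_nonempty with rfl | hs
    · exact ⟨fun _ ↦ true, by simp⟩
    -- A vertex with at most one neighbour in `s` can be coloured last. Without one, every column
    -- sum over `s` would be at most `2 - 2 = 0`, and the indicator vector of `s` would contradict
    -- positive definiteness.
    obtain ⟨k, hk, hk1⟩ : ∃ k ∈ s, ((s.erase k).filter (A · k ≠ 0)).card ≤ 1 := by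
      by_contra! hcon
      let x : I → ℤ := fun i ↦ if i ∈ s then 1 else 0
      have hx : x ≠ 0 := by
        obtain ⟨i, hi⟩ := hs
        intro h
        simpa [x, hi] using congrFun h i
      have hpos := hA.dotProduct_mulVec_pos hx
      refine hpos.not_ge ?_
      have : star x ⬝ᵥ ((A * diagonal d) *ᵥ x) = ∑ j ∈ s, (∑ i ∈ s, A i j) * d j := by
        simp only [dotProduct, mulVec, mul_diagonal, x, Pi.star_apply, star_trivial, ite_mul,
          one_mul, zero_mul, mul_ite, mul_one, mul_zero, Finset.sum_ite_mem, Finset.univ_inter,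
          Finset.sum_mul]
        exact Finset.sum_comm
      rw [this]
      refine Finset.sum_nonpos fun j hj ↦ mul_nonpos_of_nonpos_of_nonneg ?_ (hd j).le
      rw [← Finset.add_sum_erase s _ hj, hdiag]
      have h1 : ∑ i ∈ s.erase j, A i j ≤ ∑ i ∈ s.erase j, if A i j ≠ 0 then (-1 : ℤ) else 0 := by
        refine Finset.sum_le_sum fun i hi ↦ ?_
        have := hle i j (Finset.ne_of_mem_erase hi)
        split_ifs <;> omega
      rw [Finset.sum_ite, Finset.sum_const, Finset.sum_const_zero] at h1
      have := hcon j hj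
      simp only [nsmul_eq_mul, mul_neg, mul_one, add_zero] at h1
      omega
    obtain ⟨c, hc⟩ := ih (s.erase k) (Finset.erase_ssubset hk)
    obtain ⟨a, ha⟩ : ∃ a : Bool, ∀ i ∈ s.erase k, A i k ≠ 0 → c i ≠ a := by
      rcases Finset.card_le_one_iff_subsingleton.mp hk1 |>.eq_empty_or_singleton with h | ⟨l, h⟩
      · refine ⟨true, fun i hi hik ↦ ?_⟩
        have : i ∈ ((((s.erase k).filter (A · k ≠ 0)) : Finset I) : Set I) := by
          rw [Finset.mem_coe, Finset.mem_filter]; exact ⟨hi, hik⟩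
        simp [h] at this
      · refine ⟨!(c l), fun i hi hik ↦ ?_⟩
        have : i ∈ ((((s.erase k).filter (A · k ≠ 0)) : Finset I) : Set I) := by
          rw [Finset.mem_coe, Finset.mem_filter]; exact ⟨hi, hik⟩
        rw [h, Set.mem_singleton_iff] at this
        simp [this]
    refine ⟨Function.update c k a, fun i hi j hj hij hAij ↦ ?_⟩
    rcases eq_or_ne i k with rfl | hik
    · rw [Function.update_self, Function.update_of_ne hij.symm]
      exact (ha j (Finset.mem_erase.mpr ⟨hij.symm, hj⟩) (mt (hsymm j i).mp hAij)).symm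
    · rw [Function.update_of_ne hik]
      rcases eq_or_ne j k with rfl | hjk
      · rw [Function.update_self]
        exact ha i (Finset.mem_erase.mpr ⟨hik, hi⟩) hAij
      · rw [Function.update_of_ne hjk]
        exact hc i (Finset.mem_erase.mpr ⟨hik, hi⟩) j (Finset.mem_erase.mpr ⟨hjk, hj⟩) hij hAij

end Matrix

/-! ### Dihedral actions on a real plane. -/

namespace LinearEquiv

/-- Two involutions `r`, `s` of a real vector space spanned by two vectors `u`, `v` on which they
act as the reflections of a dihedral group. -/
structure IsDihedralPair {E : Type*} [AddCommGroup E] [Module ℝ E]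
    (r s : E ≃ₗ[ℝ] E) (u v : E) (c : ℝ) : Prop where
  left_ne_zero : u ≠ 0
  right_ne_zero : v ≠ 0
  span_eq_top : Submodule.span ℝ {u, v} = ⊤
  left_apply_left : r u = -u
  left_apply_right : r v = v + c • u
  right_apply_left : s u = u + c • v
  right_apply_right : s v = -v

namespace IsDihedralPair

variable {E : Type*} [AddCommGroup E] [Module ℝ E] {r s : E ≃ₗ[ℝ] E} {u v : E} {c : ℝ}

lemma symm (h : IsDihedralPair r s u v c) : IsDihedralPair s r v u c where
  left_ne_zero := h.right_ne_zero
  right_ne_zero := h.left_ne_zero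
  span_eq_top := by rw [Set.pair_comm, h.span_eq_top]
  left_apply_left := h.right_apply_right
  left_apply_right := h.right_apply_left
  right_apply_left := h.left_apply_right
  right_apply_right := h.left_apply_left

lemma ext (h : IsDihedralPair r s u v c) {g g' : E ≃ₗ[ℝ] E} (hu : g u = g' u) (hv : g v = g' v) :
    g = g' := by
  refine LinearEquiv.toLinearMap_injective (LinearMap.ext_on h.span_eq_top ?_)
  rintro x (rfl | rfl)
  exacts [hu, hv]

lemma left_mul_self (h : IsDihedralPair r s u v c) : r * r = 1 :=
  h.ext (by simp [h.left_apply_left]) (by simp [h.left_apply_left, h.left_apply_right])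

lemma right_mul_self (h : IsDihedralPair r s u v c) : s * s = 1 := h.symm.left_mul_self

lemma left_inv (h : IsDihedralPair r s u v c) : r⁻¹ = r := inv_eq_of_mul_eq_one_left h.left_mul_self

lemma mul_inv (h : IsDihedralPair r s u v c) : (r * s)⁻¹ = s * r := by
  rw [mul_inv_rev, h.left_inv, h.symm.left_inv]

lemma right_apply_zpow (h : IsDihedralPair r s u v c) (k : ℤ) (x : E) :
    s (((r * s) ^ k) x) = ((r * s) ^ (-k)) (s x) := by
  have : s * (r * s) ^ k = (r * s) ^ (-k) * s := by
    have h1 : s * (r * s) * s⁻¹ = (r * s)⁻¹ := by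
      rw [h.mul_inv, h.symm.left_inv, mul_assoc, mul_assoc, h.right_mul_self, mul_one]
    rw [zpow_neg, ← inv_zpow, ← h1, conj_zpow]
    simp
  exact LinearEquiv.congr_fun this x

/-- An eigenvalue of an operator of finite order is a root of unity, and 1 is the only positive real
one. -/
lemma eq_one_of_pos_smul {g : E ≃ₗ[ℝ] E} (hg : IsOfFinOrder g) {x : E} (hx : x ≠ 0) {a : ℝ}
    (ha : 0 < a) (hgx : g x = a • x) : g x = x := by
  obtain ⟨n, hn, hn1⟩ := isOfFinOrder_iff_pow_eq_one.mp hg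
  have h (m : ℕ) : (g ^ m) x = a ^ m • x := by
    induction m with
    | zero => simp
    | succ m ih => rw [pow_succ', LinearEquiv.mul_apply, ih, map_smul, hgx, smul_smul, pow_succ]
  have h1 := h n
  rw [hn1, LinearEquiv.coe_one, id_eq] at h1
  have h2 : (a ^ n - 1) • x = 0 := by rw [sub_smul, ← h1, one_smul, sub_self]
  have h3 : a ^ n = 1 := sub_eq_zero.mp ((smul_eq_zero.mp h2).resolve_right hx)
  rw [hgx, (pow_eq_one_iff_of_nonneg ha.le hn.ne').mp h3, one_smul]

/-- Conjugation by `s` inverts `r * s`, so a power fixing `u` also fixes `s u = u + c • v`, hence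
`v` if `c ≠ 0`. If `c = 0` then `r * s = -1` and parity decides. -/
lemma zpow_eq_one_of_apply_left (h : IsDihedralPair r s u v c) (hfin : IsOfFinOrder (r * s))
    {k : ℤ} {a : ℝ} (ha : 0 < a) (hk : ((r * s) ^ k) u = a • u) : (r * s) ^ k = 1 := by
  have hku := eq_one_of_pos_smul (hfin.zpow) h.left_ne_zero ha hk
  rcases eq_or_ne c 0 with rfl | hc
  · have hneg : r * s = LinearEquiv.neg ℝ :=
      h.ext (by simp [h.left_apply_left, h.right_apply_left])
        (by simp [h.left_apply_right, h.right_apply_right])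
    rw [hneg] at hku ⊢
    have h2 : (LinearEquiv.neg ℝ : E ≃ₗ[ℝ] E) * LinearEquiv.neg ℝ = 1 := by ext x; simp
    rcases Int.even_or_odd' k with ⟨l, rfl | rfl⟩
    · rw [zpow_mul, zpow_ofNat, pow_two, h2, one_zpow]
    · rw [zpow_add, zpow_mul, zpow_ofNat, pow_two, h2, one_zpow, one_mul, zpow_one,
        LinearEquiv.neg_apply] at hku
      have : IsAddTorsionFree E := .of_isTorsionFree ℝ E
      exact absurd (neg_eq_self.mp hku) h.left_ne_zero
  · have h1 := h.right_apply_zpow k u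
    rw [hku, h.right_apply_left, map_add, map_smul] at h1
    have hku' : ((r * s) ^ (-k)) u = u := by
      rw [zpow_neg]
      nth_rewrite 1 [← hku]
      rw [← LinearEquiv.mul_apply, inv_mul_cancel, LinearEquiv.coe_one, id_eq]
    rw [hku', add_right_inj] at h1
    have h2 := smul_right_injective E hc h1
    rw [← inv_inj, ← zpow_neg, inv_one]
    exact h.ext hku' h2.symm

lemma zpow_eq_one_of_apply_right (h : IsDihedralPair r s u v c) (hfin : IsOfFinOrder (r * s))
    {k : ℤ} {a : ℝ} (ha : 0 < a) (hk : ((r * s) ^ k) v = a • v) : (r * s) ^ k = 1 := by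
  have h1 : s * r = (r * s)⁻¹ := h.mul_inv.symm
  have := h.symm.zpow_eq_one_of_apply_left (k := -k) (by rw [h1]; exact hfin.inv) ha
    (by rwa [h1, inv_zpow', neg_neg])
  rwa [h1, inv_zpow', neg_neg] at this

lemma zpow_add_eq_one_of_apply_left_eq (h : IsDihedralPair r s u v c)
    (hfin : IsOfFinOrder (r * s)) {k : ℤ} {a : ℝ}
    (hk : ((r * s) ^ k) u = a • v) : (r * s) ^ (2 * k + 1) = 1 := by
  have h1 := h.right_apply_zpow k u
  have hsu : s u = -((r * s) ^ (-1 : ℤ)) u := by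
    rw [zpow_neg_one, h.mul_inv, LinearEquiv.mul_apply, h.left_apply_left, map_neg, neg_neg]
  rw [hk, map_smul, h.right_apply_right, hsu, map_neg, smul_neg, neg_inj, ← hk,
    ← LinearEquiv.mul_apply, ← zpow_add] at h1
  refine h.zpow_eq_one_of_apply_left hfin one_pos ?_
  rw [one_smul, show 2 * k + 1 = -(-k + -1) + k by ring, zpow_add, LinearEquiv.mul_apply, h1,
    ← LinearEquiv.mul_apply, ← zpow_add, neg_add_cancel, zpow_zero, LinearEquiv.coe_one, id_eq]

/-- The orbit of `u` cannot meet both the ray of `v` and the opposite ray. Meeting the first makes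
an odd power of `r * s` trivial, meeting both makes `(r * s) ^ (2 * (l - k))` trivial; together `(r
* s) ^ (l - k) = 1`, although this power sends `v` to a negative multiple of itself. The sign later
separates orbits of simple roots of different colours. -/
lemma exists_sign (h : IsDihedralPair r s u v c) (hfin : IsOfFinOrder (r * s)) :
    ∃ ε : ℤˣ, ∀ (k : ℤ) (a : ℝ), 0 < a → ((r * s) ^ k) u ≠ a • (ε • v) := by
  by_contra! hcon
  obtain ⟨k, a, ha, hk⟩ := hcon 1
  obtain ⟨l, b, hb, hl⟩ := hcon (-1)
  rw [one_smul] at hk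
  rw [Units.neg_smul, one_smul, smul_neg, ← neg_smul] at hl
  have hodd := h.zpow_add_eq_one_of_apply_left_eq hfin hk
  have h1 : ((r * s) ^ (l - k)) v = (-(b / a)) • v := by
    have : v = a⁻¹ • ((r * s) ^ k) u := by rw [hk, smul_smul, inv_mul_cancel₀ ha.ne', one_smul]
    nth_rewrite 1 [this]
    rw [map_smul, ← LinearEquiv.mul_apply, ← zpow_add, sub_add_cancel, hl, smul_smul]
    congr 1
    ring
  have h2 : (r * s) ^ (2 * (l - k)) = 1 := by
    refine h.zpow_eq_one_of_apply_right hfin (a := (b / a) * (b / a)) (by positivity) ?_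
    rw [two_mul, zpow_add, LinearEquiv.mul_apply, h1, map_smul, h1, smul_smul, neg_mul_neg]
  have h3 : (r * s) ^ (l - k) = 1 := by
    have : l - k = (2 * k + 1) * (l - k) + (2 * (l - k)) * (-k) := by ring
    rw [this, zpow_add, zpow_mul, zpow_mul, hodd, h2, one_zpow, one_zpow, one_mul]
  rw [h3, LinearEquiv.coe_one, id_eq] at h1
  have h4 : (1 + b / a) • v = 0 := by
    rw [add_smul, one_smul]
    nth_rewrite 1 [h1]
    rw [neg_smul, neg_add_cancel]
  have : 0 < 1 + b / a := by positivity
  exact (smul_eq_zero.mp h4).elim this.ne' h.right_ne_zero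

end IsDihedralPair

end LinearEquiv

/-! ### Words in simple reflections. -/

namespace RootPairing

variable {ι R M N : Type*} [CommRing R] [AddCommGroup M] [Module R M] [AddCommGroup N] [Module R N]
  (P : RootPairing ι R M N)

lemma root_prod_reflectionPerm (l : List ι) (i : ι) :
    P.root ((l.map P.reflectionPerm).prod i) = (l.map P.reflection).prod (P.root i) := by
  induction l with
  | nil => simp
  | cons j l ih => simp [Equiv.Perm.mul_apply, LinearEquiv.mul_apply, root_reflectionPerm, ih]

lemma reflectionPerm_prod_reflectionPerm (l : List ι) (i : ι) :
    P.reflectionPerm ((l.map P.reflectionPerm).prod i) =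
      (l.map P.reflectionPerm).prod * P.reflectionPerm i * (l.map P.reflectionPerm).prod⁻¹ := by
  induction l with
  | nil => simp
  | cons j l ih =>
    have h (k : ι) : P.reflectionPerm (P.reflectionPerm j k) =
        P.reflectionPerm j * P.reflectionPerm k * P.reflectionPerm j := by
      ext m
      apply P.root.injective
      simp [Equiv.Perm.mul_apply, root_reflectionPerm, reflection_reflectionPerm]
    rw [List.map_cons, List.prod_cons, Equiv.Perm.mul_apply, h, ih, mul_inv_rev,
      reflectionPerm_inv]
    group

namespace Base

variable {P} (b : P.Base) [CharZero R] [IsDomain R] [Finite ι] [P.IsCrystallographic] [P.IsReduced]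

/-- The exchange argument: if a product of simple reflections makes a simple root negative, then
multiplying it by the simple reflection is a shorter product of simple reflections. -/
lemma exists_prod_reflectionPerm_mul_eq (l : List ι) (hl : ∀ i ∈ l, i ∈ b.support)
    {k : ι} (hk : k ∈ b.support) (hneg : ¬ b.IsPos ((l.map P.reflectionPerm).prod k)) :
    ∃ l' : List ι, (∀ i ∈ l', i ∈ b.support) ∧ l'.length < l.length ∧
      (l.map P.reflectionPerm).prod * P.reflectionPerm k = (l'.map P.reflectionPerm).prod := by
  induction l with
  | nil => exact absurd (isPos_of_mem_support hk) (by simpa using hneg)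
  | cons j l ih =>
    have hl' : ∀ i ∈ l, i ∈ b.support := fun i hi ↦ hl i (List.mem_cons_of_mem _ hi)
    have hj : j ∈ b.support := hl j List.mem_cons_self
    by_cases hpos : b.IsPos ((l.map P.reflectionPerm).prod k)
    · have : (l.map P.reflectionPerm).prod k = j := by
        by_contra hne
        refine hneg ?_
        rw [List.map_cons, List.prod_cons, Equiv.Perm.mul_apply]
        exact hpos.reflectionPerm hj hne
      refine ⟨l, hl', by simp, ?_⟩
      have hconj := P.reflectionPerm_prod_reflectionPerm l k
      rw [this] at hconj
      have hsq : P.reflectionPerm k * P.reflectionPerm k = 1 := by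
        rw [← pow_two, reflectionPerm_sq]
      rw [List.map_cons, List.prod_cons, hconj, inv_mul_cancel_right, mul_assoc, hsq, mul_one]
    · obtain ⟨l', h1, h2, h3⟩ := ih hl' hpos
      refine ⟨j :: l', by simpa using ⟨hj, h1⟩, by simpa using h2, ?_⟩
      rw [List.map_cons, List.prod_cons, mul_assoc, h3, List.map_cons, List.prod_cons]

/-- A product of simple reflections preserving positivity is trivial. -/
lemma prod_reflectionPerm_eq_one (l : List ι) (hl : ∀ i ∈ l, i ∈ b.support)
    (hpos : ∀ i, b.IsPos i → b.IsPos ((l.map P.reflectionPerm).prod i)) :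
    (l.map P.reflectionPerm).prod = 1 := by
  induction hn : l.length using Nat.strong_induction_on generalizing l with
  | _ n ih =>
    rcases l.eq_nil_or_concat with rfl | ⟨l₀, k, rfl⟩
    · simp
    rw [List.concat_eq_append] at *
    have hk : k ∈ b.support := hl k (by simp)
    have hl₀ : ∀ i ∈ l₀, i ∈ b.support := fun i hi ↦ hl i (by simp [hi])
    have hprod : ((l₀ ++ [k]).map P.reflectionPerm).prod =
        (l₀.map P.reflectionPerm).prod * P.reflectionPerm k := by simp
    -- The whole word keeps `k` positive while its last letter negates `k`, so the remaining word
    -- makes `k` negative and the exchange applies.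
    have hneg : ¬ b.IsPos ((l₀.map P.reflectionPerm).prod k) := by
      intro hcon
      have h1 := hpos k (isPos_of_mem_support hk)
      rw [hprod, Equiv.Perm.mul_apply] at h1
      have h2 : P.root ((l₀.map P.reflectionPerm).prod (P.reflectionPerm k k)) =
          -P.root ((l₀.map P.reflectionPerm).prod k) := by
        rw [root_prod_reflectionPerm, root_prod_reflectionPerm, root_reflectionPerm,
          reflection_apply_self, map_neg]
      have h3 : (l₀.map P.reflectionPerm).prod (P.reflectionPerm k k) =
          P.reflectionPerm ((l₀.map P.reflectionPerm).prod k)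
            ((l₀.map P.reflectionPerm).prod k) := by
        apply P.root.injective
        rw [h2, root_reflectionPerm, reflection_apply_self]
      rw [h3] at h1
      exact (IsPos.neg_iff_not b _).mp h1 hcon
    obtain ⟨l', h1, h2, h3⟩ := b.exists_prod_reflectionPerm_mul_eq l₀ hl₀ hk hneg
    rw [hprod, h3] at hpos ⊢
    refine ih l'.length ?_ l' h1 hpos rfl
    rw [← hn, List.length_append]
    omega

end Base

end RootPairing

/-! ### Root coordinates and the two colour classes of simple reflections. -/

namespace RootPairing

namespace Base

section Coeff

variable {ι R M N : Type*} [CommRing R] [AddCommGroup M] [Module R M] [AddCommGroup N] [Module R N]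
  {P : RootPairing ι R M N} (b : P.Base) [CharZero R]

/-- The coordinates of a root with respect to the simple roots. -/
noncomputable def rootCoeff (i : ι) (j : b.support) : ℤ := (b.exists_root_eq_sum_int i).choose j

lemma root_eq_sum_rootCoeff (i : ι) : P.root i = ∑ j, b.rootCoeff i j • P.root j := by
  exact (b.exists_root_eq_sum_int i).choose_spec.2.2.trans (Finset.sum_coe_sort b.support
    fun j ↦ (b.exists_root_eq_sum_int i).choose j • P.root j).symm

lemma height_eq_sum_rootCoeff (i : ι) : b.height i = ∑ j, b.rootCoeff i j :=
  (Finset.sum_coe_sort b.support (b.exists_root_eq_sum_int i).choose).symm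

lemma rootCoeff_nonneg_or_nonpos (i : ι) :
    (∀ j, 0 ≤ b.rootCoeff i j) ∨ (∀ j, b.rootCoeff i j ≤ 0) :=
  (b.exists_root_eq_sum_int i).choose_spec.2.1.imp (fun h j ↦ h.le j) (fun h j ↦ h.le j)

lemma eq_rootCoeff_of_root_eq_sum {i : ι} {g : b.support → ℤ}
    (hg : P.root i = ∑ j, g j • P.root j) : b.rootCoeff i = g := by
  have hli : LinearIndependent ℤ (fun j : b.support ↦ P.root j) :=
    (b.linearIndepOn_root.restrict_scalars' ℤ)
  rw [root_eq_sum_rootCoeff] at hg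
  funext j
  exact Fintype.linearIndependent_iffₛ.mp hli _ _ hg j

lemma rootCoeff_self [DecidableEq ι] (i j : b.support) :
    b.rootCoeff i j = if j = i then 1 else 0 := by
  have := b.eq_rootCoeff_of_root_eq_sum (i := i) (g := fun j ↦ if j = i then 1 else 0) (by simp)
  exact congrFun this j

/-- The coordinates of a root all have one sign, so any positive weights detect positivity as well
as the height does. -/
lemma isPos_iff_sum_mul_rootCoeff_pos {y : b.support → ℝ} (hy : ∀ j, 0 < y j) (i : ι) :
    b.IsPos i ↔ 0 < ∑ j, y j * b.rootCoeff i j := by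
  have hne := b.height_ne_zero i
  rw [isPos_iff]
  rw [height_eq_sum_rootCoeff] at hne ⊢
  rcases b.rootCoeff_nonneg_or_nonpos i with h | h
  · have hpos : 0 < ∑ j, b.rootCoeff i j := (Finset.sum_nonneg fun j _ ↦ h j).lt_of_ne' hne
    obtain ⟨j, -, hj⟩ := Finset.exists_ne_zero_of_sum_ne_zero hne
    refine iff_of_true hpos (Finset.sum_pos' (fun k _ ↦ ?_) ⟨j, Finset.mem_univ j, ?_⟩)
    · exact mul_nonneg (hy k).le (Int.cast_nonneg (h k))
    · exact mul_pos (hy j) (Int.cast_pos.mpr ((h j).lt_of_ne' hj))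
  · refine iff_of_false (Finset.sum_nonpos fun j _ ↦ h j).not_gt
      (Finset.sum_nonpos fun j _ ↦ ?_).not_gt
    exact mul_nonpos_of_nonneg_of_nonpos (hy j).le (Int.cast_nonpos.mpr (h j))

variable [P.IsCrystallographic]

lemma pairingIn_eq_sum_rootCoeff (i : ι) (j : b.support) :
    P.pairingIn ℤ i j = ∑ k, b.rootCoeff i k * b.cartanMatrix k j := by
  apply FaithfulSMul.algebraMap_injective ℤ R
  simp_rw [cartanMatrix, cartanMatrixIn_def, map_sum, map_mul, algebraMap_pairingIn,
    ← root_coroot_eq_pairing]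
  rw [b.root_eq_sum_rootCoeff i]
  simp [map_sum, LinearMap.sum_apply]

lemma rootCoeff_reflectionPerm [DecidableEq ι] (i : ι) (j k : b.support) :
    b.rootCoeff (P.reflectionPerm j i) k =
      b.rootCoeff i k - if k = j then P.pairingIn ℤ i j else 0 := by
  refine congrFun (b.eq_rootCoeff_of_root_eq_sum
    (g := fun k ↦ b.rootCoeff i k - if k = j then P.pairingIn ℤ i j else 0) ?_) k
  rw [root_reflectionPerm, reflection_apply_root' ℤ, b.root_eq_sum_rootCoeff i]
  simp [sub_smul, Finset.sum_sub_distrib, ite_smul]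

/-- Reflections in mutually orthogonal simple roots do not change each other's pairings, so their
corrections simply add up. -/
lemma rootCoeff_prod_reflectionPerm [DecidableEq ι] (l : List b.support) (hl : l.Nodup)
    (horth : ∀ j ∈ l, ∀ k ∈ l, j ≠ k → b.cartanMatrix j k = 0) (i : ι) (k : b.support) :
    b.rootCoeff ((l.map fun j : b.support ↦ P.reflectionPerm j).prod i) k =
      b.rootCoeff i k - if k ∈ l then P.pairingIn ℤ i k else 0 := by
  induction l generalizing k with
  | nil => simp
  | cons j l ih =>
    rw [List.nodup_cons] at hl
    have ih' := ih hl.2 fun m hm n hn ↦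
      horth m (List.mem_cons_of_mem _ hm) n (List.mem_cons_of_mem _ hn)
    rw [List.map_cons, List.prod_cons, Equiv.Perm.mul_apply, rootCoeff_reflectionPerm, ih']
    have hpair : P.pairingIn ℤ ((l.map fun j : b.support ↦ P.reflectionPerm j).prod i) j =
        P.pairingIn ℤ i j := by
      rw [pairingIn_eq_sum_rootCoeff, pairingIn_eq_sum_rootCoeff]
      refine Finset.sum_congr rfl fun m _ ↦ ?_
      rw [ih' m]
      split_ifs with hm
      · rw [horth m (List.mem_cons_of_mem _ hm) j List.mem_cons_self
          (fun h ↦ hl.1 (h ▸ hm)), mul_zero, mul_zero]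
      · rw [sub_zero]
    rw [hpair]
    by_cases hkj : k = j
    · subst hkj
      simp [hl.1]
    · simp [hkj]

end Coeff

section Bipartite

variable {ι R M N : Type*} [CommRing R] [AddCommGroup M] [Module R M] [AddCommGroup N] [Module R N]
  {P : RootPairing ι R M N} (b : P.Base) [CharZero R] [P.IsCrystallographic]

/-- The weighted sum of the coordinates of a root belonging to one colour class of simple roots. -/
noncomputable def colorSum (col : b.support → Bool) (y : b.support → ℝ) (a : Bool) (i : ι) : ℝ :=
  ∑ k, if col k = a then y k * b.rootCoeff i k else 0

omit [P.IsCrystallographic] in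
lemma colorSum_add_colorSum (col : b.support → Bool) (y : b.support → ℝ) (i : ι) :
    b.colorSum col y true i + b.colorSum col y false i = ∑ k, y k * b.rootCoeff i k := by
  rw [colorSum, colorSum, ← Finset.sum_add_distrib]
  refine Finset.sum_congr rfl fun k _ ↦ ?_
  cases col k <;> simp

omit [P.IsCrystallographic] in
lemma colorSum_simple (col : b.support → Bool) (y : b.support → ℝ) (a : Bool) (i : b.support) :
    b.colorSum col y a i = if col i = a then y i else 0 := by
  classical
  rw [colorSum, Finset.sum_eq_single i]
  · simp [rootCoeff_self]
  · intro j _ hj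
    simp [rootCoeff_self, hj]
  · simp

omit [P.IsCrystallographic] in
lemma colorSum_reflectionPerm_self (col : b.support → Bool) (y : b.support → ℝ) (a : Bool) (i : ι) :
    b.colorSum col y a (P.reflectionPerm i i) = -b.colorSum col y a i := by
  have : b.rootCoeff (P.reflectionPerm i i) = fun k ↦ -b.rootCoeff i k := by
    apply b.eq_rootCoeff_of_root_eq_sum
    rw [root_reflectionPerm, reflection_apply_self]
    nth_rewrite 1 [b.root_eq_sum_rootCoeff i]
    simp
  rw [colorSum, colorSum, this, ← Finset.sum_neg_distrib]
  refine Finset.sum_congr rfl fun k _ ↦ ?_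
  split_ifs <;> simp

variable {col : b.support → Bool} {y : b.support → ℝ} {c : ℝ}
  (hcol : ∀ i j, i ≠ j → b.cartanMatrix i j ≠ 0 → col i ≠ col j)

include hcol

lemma colorSum_prod_reflectionPerm_of_ne (a : Bool) (l : List b.support) (hl : l.Nodup)
    (hmem : ∀ j, j ∈ l ↔ col j = a) (i : ι) :
    b.colorSum col y (!a) ((l.map fun j : b.support ↦ P.reflectionPerm j).prod i) =
      b.colorSum col y (!a) i := by
  classical
  refine Finset.sum_congr rfl fun k _ ↦ ?_
  rw [b.rootCoeff_prod_reflectionPerm l hl fun j hj k hk hjk ↦ by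
    by_contra h
    exact hcol j k hjk h (((hmem j).mp hj).trans ((hmem k).mp hk).symm)]
  by_cases hk : col k = a <;> simp [hmem, hk]

/-- Off-diagonal Cartan entries only join different colours. Hence the eigenvector equation, summed
over the colour `a` alone, gives `2 * y m` when `m` has that colour and `-(c * y m)` otherwise. The
pair of colour sums is thus transformed by a reflection of the plane. -/
lemma colorSum_prod_reflectionPerm (a : Bool) (l : List b.support) (hl : l.Nodup)
    (hmem : ∀ j, j ∈ l ↔ col j = a)
    (hy : ∀ i, ∑ j, (b.cartanMatrix i j : ℝ) * y j = (2 - c) * y i) (i : ι) :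
    b.colorSum col y a ((l.map fun j : b.support ↦ P.reflectionPerm j).prod i) =
      -b.colorSum col y a i + c * b.colorSum col y (!a) i := by
  classical
  have hA (m : b.support) : ∑ k, (if col k = a then y k * b.cartanMatrix m k else 0) =
      if col m = a then 2 * y m else -(c * y m) := by
    by_cases hm : col m = a
    · rw [if_pos hm, Finset.sum_eq_single m]
      · rw [if_pos hm, cartanMatrix_apply_same]
        push_cast
        ring
      · intro k _ hk
        split_ifs with hka
        · have : b.cartanMatrix m k = 0 := by
            by_contra h
            exact hcol m k hk.symm h (hm.trans hka.symm)
          simp [this]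
        · rfl
      · simp
    · rw [if_neg hm]
      have h1 : ∑ k, (if col k = a then y k * b.cartanMatrix m k else 0) =
          ∑ k, ((b.cartanMatrix m k : ℝ) * y k - if k = m then 2 * y m else 0) := by
        refine Finset.sum_congr rfl fun k _ ↦ ?_
        by_cases hk : k = m
        · subst hk
          simp [hm]
        · split_ifs with hka
          · ring
          · have : b.cartanMatrix m k = 0 := by
              by_contra h
              have := hcol m k (Ne.symm hk) h
              revert this hm hka
              cases col k <;> cases col m <;> cases a <;> simp
            simp [this]
      rw [h1, Finset.sum_sub_distrib, hy, Finset.sum_ite_eq' Finset.univ m,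
        if_pos (Finset.mem_univ m)]
      ring
  have h2 : b.colorSum col y a ((l.map fun j : b.support ↦ P.reflectionPerm j).prod i) =
      b.colorSum col y a i -
        ∑ k, if col k = a then y k * ∑ m, (b.rootCoeff i m : ℝ) * b.cartanMatrix m k else 0 := by
    rw [colorSum, colorSum, ← Finset.sum_sub_distrib]
    refine Finset.sum_congr rfl fun k _ ↦ ?_
    rw [b.rootCoeff_prod_reflectionPerm l hl fun j hj k hk hjk ↦ by
      by_contra h
      exact hcol j k hjk h (((hmem j).mp hj).trans ((hmem k).mp hk).symm)]
    by_cases hk : col k = a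
    · simp only [hk, if_true, hmem, pairingIn_eq_sum_rootCoeff]
      push_cast
      ring
    · simp [hk]
  have h3 : ∑ k, (if col k = a then y k * ∑ m, (b.rootCoeff i m : ℝ) * b.cartanMatrix m k else 0) =
      ∑ m, (b.rootCoeff i m : ℝ) * if col m = a then 2 * y m else -(c * y m) := by
    simp_rw [← hA, Finset.mul_sum]
    rw [Finset.sum_comm]
    refine Finset.sum_congr rfl fun k _ ↦ ?_
    split_ifs
    · exact Finset.sum_congr rfl fun m _ ↦ by ring
    · simp
  rw [h2, h3, colorSum, colorSum, Finset.mul_sum, ← Finset.sum_neg_distrib,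
    ← Finset.sum_add_distrib, ← Finset.sum_sub_distrib]
  refine Finset.sum_congr rfl fun m _ ↦ ?_
  by_cases hm : col m = a
  · simp [hm]
    ring
  · have : col m = !a := by revert hm; cases col m <;> cases a <;> simp
    simp [this]
    ring

end Bipartite

end Base

end RootPairing

/-! ### The order of a bipartite Coxeter element. -/

namespace RootPairing

namespace Base

variable {ι K M N : Type*} [Field K] [CharZero K] [AddCommGroup M] [Module K M] [AddCommGroup N]
  [Module K N] {P : RootPairing ι K M N} (b : P.Base) [Finite ι]
  [P.IsCrystallographic] [P.IsReduced]

lemma exists_pos_cartanMatrix_mulVec [Nonempty ι] [P.IsIrreducible] :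
    ∃ (c : ℝ) (y : b.support → ℝ), (∀ i, 0 < y i) ∧
      ∀ i, ∑ j, (b.cartanMatrix i j : ℝ) * y j = (2 - c) * y i := by
  classical
  obtain ⟨d, hd, hd'⟩ := b.exists_cartanMatrix_mul_diagaonal_posDef
  have : Nonempty b.support := b.support_nonempty.to_subtype
  -- This is `2 - A` for the Cartan matrix `A`, so `B y = c y` means `A y = (2 - c) y`.
  let B : Matrix b.support b.support ℝ := Matrix.of fun i j ↦
    if i = j then 0 else -(b.cartanMatrix i j : ℝ)
  have hB (i j : b.support) : B i j = if i = j then 0 else -(b.cartanMatrix i j : ℝ) := rfl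
  obtain ⟨c, y, hy, hBy⟩ := B.exists_pos_mulVec_eq_smul (fun i ↦ (d i : ℝ))
    (fun i ↦ by exact_mod_cast hd i)
    (fun i j ↦ by
      have := hd'.isHermitian.apply i j
      simp only [Matrix.mul_diagonal, star_trivial] at this
      rw [hB, hB]
      rcases eq_or_ne i j with rfl | hij
      · rfl
      · rw [if_neg hij, if_neg hij.symm]
        have h' : (b.cartanMatrix j i : ℝ) * d i = b.cartanMatrix i j * d j := by
          exact_mod_cast this
        linarith)
    (fun i j ↦ by
      rw [hB]
      split_ifs with hij
      · exact le_rfl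
      · have := b.cartanMatrix_le_zero_of_ne i j hij
        simpa using this)
    (fun p i j hi hp ↦ b.induction_on_cartanMatrix p hi fun k l hk hlk ↦ by
      rcases eq_or_ne l k with rfl | h
      · exact hk
      · refine hp k l hk ?_
        rw [hB, if_neg h]
        simpa using hlk)
  refine ⟨c, y, hy, fun i ↦ ?_⟩
  have h1 := congrFun hBy i
  simp only [Matrix.mulVec, dotProduct, Pi.smul_apply, smul_eq_mul] at h1
  rw [sub_mul, ← h1, eq_sub_iff_add_eq, ← Finset.sum_add_distrib, Finset.sum_eq_single i]
  · simp [hB]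
  · intro j _ hj
    simp [hB, hj.symm]
  · simp

/-- In an irreducible reduced crystallographic root system of rank `n`, some Coxeter element `w` has
`n * orderOf w` at most the number of roots. -/
theorem exists_list_card_mul_orderOf_le [Nonempty ι] [P.IsIrreducible] :
    ∃ l : List ι, l.Nodup ∧ (∀ i, i ∈ l ↔ i ∈ b.support) ∧
      b.support.card * orderOf (l.map P.reflection).prod ≤ Nat.card ι := by
  classical
  obtain ⟨d, hd, hd'⟩ := b.exists_cartanMatrix_mul_diagaonal_posDef
  obtain ⟨col, hcol⟩ := b.cartanMatrix.exists_coloring_of_posDef_mul_diagonal d hd hd'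
    b.cartanMatrix_apply_same b.cartanMatrix_le_zero_of_ne
    fun i j ↦ b.cartanMatrix_apply_eq_zero_iff_symm
  obtain ⟨c, y, hy, hAy⟩ := b.exists_pos_cartanMatrix_mulVec
  let L (a : Bool) : List b.support := (Finset.univ.filter (col · = a)).toList
  have hLnodup (a : Bool) : (L a).Nodup := Finset.nodup_toList _
  have hLmem (a : Bool) (j : b.support) : j ∈ L a ↔ col j = a := by simp [L]
  let T (a : Bool) : Equiv.Perm ι := ((L a).map fun j : b.support ↦ P.reflectionPerm j).prod
  let l : List ι := (L true ++ L false).map Subtype.val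
  have hlmem (i : ι) : i ∈ l ↔ i ∈ b.support := by
    simp only [l, List.mem_map, List.mem_append, hLmem]
    refine ⟨?_, fun hi ↦ ⟨⟨i, hi⟩, by cases col ⟨i, hi⟩ <;> simp, rfl⟩⟩
    rintro ⟨j, -, rfl⟩
    exact j.2
  have hlnodup : l.Nodup := by
    refine List.Nodup.map Subtype.val_injective (List.nodup_append.mpr ⟨hLnodup _, hLnodup _, ?_⟩)
    rintro j hj _ hk rfl
    rw [hLmem] at hj hk
    simp [hj] at hk
  refine ⟨l, hlnodup, hlmem, ?_⟩
  let τ : Equiv.Perm ι := (l.map P.reflectionPerm).prod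
  have hτ : τ = T true * T false := by simp [τ, T, l]
  -- The plane on which the Coxeter element acts as a rotation.
  let r : (ℝ × ℝ) ≃ₗ[ℝ] (ℝ × ℝ) := LinearEquiv.ofInvolutive
    ((-LinearMap.fst ℝ ℝ ℝ + c • LinearMap.snd ℝ ℝ ℝ).prod (LinearMap.snd ℝ ℝ ℝ))
    (fun x ↦ by ext <;> simp)
  let s : (ℝ × ℝ) ≃ₗ[ℝ] (ℝ × ℝ) := LinearEquiv.ofInvolutive
    ((LinearMap.fst ℝ ℝ ℝ).prod (-LinearMap.snd ℝ ℝ ℝ + c • LinearMap.fst ℝ ℝ ℝ))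
    (fun x ↦ by ext <;> simp)
  have hr (x y : ℝ) : r (x, y) = (-x + c * y, y) := rfl
  have hs (x y : ℝ) : s (x, y) = (x, -y + c * x) := rfl
  have hdih : LinearEquiv.IsDihedralPair r s (1, 0) (0, 1) c :=
    { left_ne_zero := by simp
      right_ne_zero := by simp
      span_eq_top := by
        rw [eq_top_iff]
        rintro ⟨x, z⟩ -
        exact Submodule.mem_span_pair.mpr ⟨x, z, by simp⟩
      left_apply_left := by simp [hr]
      left_apply_right := by simp [hr]
      right_apply_left := by simp [hs]
      right_apply_right := by simp [hs] }
  let π (i : ι) : ℝ × ℝ := (b.colorSum col y true i, b.colorSum col y false i)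
  have hπT (i : ι) : π (T true i) = r (π i) := by
    rw [hr]
    exact Prod.ext (b.colorSum_prod_reflectionPerm hcol true _ (hLnodup _) (hLmem _) hAy i)
      (b.colorSum_prod_reflectionPerm_of_ne hcol true _ (hLnodup _) (hLmem _) i)
  have hπF (i : ι) : π (T false i) = s (π i) := by
    rw [hs]
    exact Prod.ext (b.colorSum_prod_reflectionPerm_of_ne hcol false _ (hLnodup _) (hLmem _) i)
      (b.colorSum_prod_reflectionPerm hcol false _ (hLnodup _) (hLmem _) hAy i)
  have hπτ (i : ι) : π (τ i) = (r * s) (π i) := by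
    rw [hτ, Equiv.Perm.mul_apply, hπT, hπF, LinearEquiv.mul_apply]
  have hπpow (k : ℕ) (i : ι) : π ((τ ^ k) i) = ((r * s) ^ k) (π i) := by
    induction k generalizing i with
    | zero => simp
    | succ k ih => rw [pow_succ, pow_succ, Equiv.Perm.mul_apply, ih, hπτ, ← LinearEquiv.mul_apply]
  have hπsimple (i : b.support) : π i = if col i = true then y i • (1, 0) else y i • (0, 1) := by
    ext <;> simp only [π, colorSum_simple] <;> cases col i <;> simp
  -- If `c ≠ 0`, both colours occur, so the images of the simple roots span the plane and the order
  -- of `τ` is a period of `r * s`.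
  have hfin : IsOfFinOrder (r * s) := by
    rcases eq_or_ne c 0 with rfl | hc
    · refine isOfFinOrder_iff_pow_eq_one.mpr ⟨2, two_pos, ?_⟩
      refine hdih.ext ?_ ?_ <;> simp [pow_two, hr, hs]
    -- With a single colour the Cartan matrix would be diagonal, and the eigenvector equation would
    -- force `c = 0`.
    · have hboth (a : Bool) : ∃ i, col i = a := by
        by_contra! hcon
        obtain ⟨i₀, hi₀⟩ := b.support_nonempty
        let i : b.support := ⟨i₀, hi₀⟩
        have h1 := hAy i
        rw [Finset.sum_eq_single i, cartanMatrix_apply_same] at h1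
        · have : c * y i = 0 := by push_cast at h1; linarith
          exact hc ((mul_eq_zero.mp this).resolve_right (hy i).ne')
        · intro j _ hj
          have : b.cartanMatrix i j = 0 := by
            by_contra h
            have := hcol i j hj.symm h
            have hi := hcon i
            have hj := hcon j
            revert this hi hj
            cases col i <;> cases col j <;> cases a <;> simp
          simp [this]
        · simp
      refine isOfFinOrder_iff_pow_eq_one.mpr ⟨orderOf τ, orderOf_pos τ, ?_⟩
      have key (i : b.support) : ((r * s) ^ orderOf τ) (π i) = π i := by
        rw [← hπpow, pow_orderOf_eq_one, Equiv.Perm.one_apply]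
      obtain ⟨i, hi⟩ := hboth true
      obtain ⟨j, hj⟩ := hboth false
      have hi' := key i
      have hj' := key j
      rw [hπsimple, if_pos hi, map_smul] at hi'
      rw [hπsimple, if_neg (by simp [hj]), map_smul] at hj'
      exact hdih.ext (smul_right_injective _ (hy i).ne' hi') (smul_right_injective _ (hy j).ne' hj')
  -- A power acting trivially on the plane preserves the sum of the two colour sums, whose sign is
  -- that of the root. It is a word in simple reflections preserving positivity, hence trivial.
  have hfaithful (k : ℤ) (hk : (r * s) ^ k = 1) : τ ^ k = 1 := by
    rw [← pow_natAbs_eq_one] at hk ⊢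
    set n := k.natAbs
    let l' : List ι := (List.replicate n l).flatten
    have hl' : (l'.map P.reflectionPerm).prod = τ ^ n := by
      simp [l', τ, List.map_flatten, List.prod_flatten]
    rw [← hl']
    refine b.prod_reflectionPerm_eq_one l' (fun i hi ↦ ?_) fun i hi ↦ ?_
    · obtain ⟨m, hm, him⟩ := List.mem_flatten.mp hi
      rw [List.eq_of_mem_replicate hm] at him
      exact (hlmem i).mp him
    · rw [hl']
      have h1 := hπpow n i
      rw [hk, LinearEquiv.coe_one, id_eq] at h1
      rw [b.isPos_iff_sum_mul_rootCoeff_pos hy, ← b.colorSum_add_colorSum col] at hi ⊢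
      rwa [show b.colorSum col y true ((τ ^ n) i) = b.colorSum col y true i from
        congrArg Prod.fst h1,
        show b.colorSum col y false ((τ ^ n) i) = b.colorSum col y false i from
        congrArg Prod.snd h1]
  have hπzpow (k : ℤ) (i : ι) : π ((τ ^ k) i) = ((r * s) ^ k) (π i) := by
    obtain ⟨n, rfl | rfl⟩ := k.eq_nat_or_neg
    · simpa using hπpow n i
    · have := hπpow n ((τ ^ (-(n : ℤ))) i)
      rw [← zpow_natCast, ← Equiv.Perm.mul_apply, ← zpow_add, add_neg_cancel, zpow_zero,
        Equiv.Perm.one_apply] at this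
      rw [this, ← zpow_natCast, ← LinearEquiv.mul_apply, ← zpow_add, neg_add_cancel, zpow_zero,
        LinearEquiv.coe_one, id_eq]
  -- Simple roots up to sign, lying in different orbits of the Coxeter element.
  obtain ⟨ε, hε⟩ := hdih.exists_sign hfin
  let a (i : b.support) : ι :=
    if col i = true ∨ ε = 1 then i else P.reflectionPerm i i
  have hπneg (i : ι) : π (P.reflectionPerm i i) = -π i := by
    ext <;> simp [π, colorSum_reflectionPerm_self]
  have hπa (i : b.support) :
      π (a i) = y i • (if col i = true then ((1, 0) : ℝ × ℝ) else ε • (0, 1)) := by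
    by_cases hi : col i = true
    · simp [a, hi, hπsimple]
    · rcases Int.units_eq_one_or ε with h1 | h1
      · simp [a, hi, hπsimple, h1]
      · simp [a, hi, hπsimple, h1, hπneg, Units.neg_smul]
  have ha_inj : ∀ i j : b.support, col i = col j → a i = a j → i = j := by
    intro i j hij h
    simp only [a, hij] at h
    split_ifs at h
    · exact Subtype.ext h
    · have h2 := congrArg P.root h
      rw [root_reflectionPerm, root_reflectionPerm, reflection_apply_self, reflection_apply_self,
        neg_inj] at h2
      exact Subtype.ext (P.root.injective h2)
  have hzpow_false (k : ℤ) (i j : b.support) (hi : col i = true) (hj : col j = false)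
      (h : (τ ^ k) (a i) = a j) : False := by
    have h1 := congrArg π h
    rw [hπzpow, hπa, hπa, if_pos hi, if_neg (by simp [hj]), map_smul] at h1
    refine hε k (y j / y i) (div_pos (hy j) (hy i)) ?_
    rw [div_eq_inv_mul, ← smul_smul, ← h1, smul_smul, inv_mul_cancel₀ (hy i).ne', one_smul]
  have hzpow_eq (k : ℤ) (i j : b.support) (hij : col i = col j)
      (h : (τ ^ k) (a i) = a j) : τ ^ k = 1 := by
    have h1 := congrArg π h
    rw [hπzpow, hπa, hπa, ← hij, map_smul] at h1
    have h2 (x : ℝ × ℝ) (hx : y i • ((r * s) ^ k) x = y j • x) :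
        ((r * s) ^ k) x = (y j / y i) • x := by
      rw [div_eq_inv_mul, ← smul_smul, ← hx, smul_smul, inv_mul_cancel₀ (hy i).ne', one_smul]
    have hpos : 0 < y j / y i := div_pos (hy j) (hy i)
    apply hfaithful
    by_cases hi : col i = true
    · rw [if_pos hi] at h1
      exact hdih.zpow_eq_one_of_apply_left hfin hpos (h2 _ h1)
    · rw [if_neg hi] at h1
      refine hdih.zpow_eq_one_of_apply_right hfin hpos (h2 _ ?_)
      rcases Int.units_eq_one_or ε with h3 | h3
      · simpa [h3] using h1
      · rw [h3, Units.neg_smul, one_smul, map_neg, smul_neg, smul_neg, neg_inj] at h1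
        exact h1
  -- For equal colours a coincidence of orbits makes the power of `τ` trivial; for different colours
  -- the choice of `ε` excludes it.
  let Ψ : b.support × Fin (orderOf τ) → ι := fun x ↦ (τ ^ (x.2 : ℕ)) (a x.1)
  have hΨ : Function.Injective Ψ := by
    rintro ⟨i, m⟩ ⟨j, n⟩ h
    have h1 : (τ ^ ((m : ℤ) - n)) (a i) = a j := by
      have h' : (τ ^ (m : ℤ)) (a i) = (τ ^ (n : ℤ)) (a j) := by simpa [Ψ] using h
      rw [sub_eq_neg_add, zpow_add, Equiv.Perm.mul_apply, h', ← Equiv.Perm.mul_apply, ← zpow_add,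
        neg_add_cancel, zpow_zero, Equiv.Perm.one_apply]
    have h1' : (τ ^ (-((m : ℤ) - n))) (a j) = a i := by
      rw [← h1, ← Equiv.Perm.mul_apply, ← zpow_add, neg_add_cancel, zpow_zero, Equiv.Perm.one_apply]
    have hij : col i = col j := by
      rcases hi : col i with _ | _ <;> rcases hj : col j with _ | _
      · rfl
      · exact (hzpow_false _ j i hj hi h1').elim
      · exact (hzpow_false _ i j hi hj h1).elim
      · rfl
    have h2 := hzpow_eq _ i j hij h1
    rw [h2, Equiv.Perm.one_apply] at h1
    have h3 : τ ^ (m : ℕ) = τ ^ (n : ℕ) := by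
      rw [← zpow_natCast, ← zpow_natCast]
      rwa [zpow_sub, mul_inv_eq_one] at h2
    exact Prod.ext (ha_inj i j hij h1)
      (Fin.ext (pow_injOn_Iio_orderOf m.isLt n.isLt h3))
  have hcard : b.support.card * orderOf τ ≤ Nat.card ι := by
    have := Nat.card_le_card_of_injective Ψ hΨ
    simpa using this
  refine le_trans (Nat.mul_le_mul_left _ (Nat.le_of_dvd (orderOf_pos τ) ?_)) hcard
  rw [orderOf_dvd_iff_pow_eq_one]
  have hpow (k : ℕ) (i : ι) : P.root ((τ ^ k) i) = ((l.map P.reflection).prod ^ k) (P.root i) := by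
    induction k generalizing i with
    | zero => simp
    | succ k ih =>
      rw [pow_succ, pow_succ, Equiv.Perm.mul_apply, ih, root_prod_reflectionPerm,
        LinearEquiv.mul_apply]
  refine LinearEquiv.toLinearMap_injective (LinearMap.ext_on_range
    (IsRootSystem.span_root_eq_top (P := P)) fun i ↦ ?_)
  have := hpow (orderOf τ) i
  rw [pow_orderOf_eq_one, Equiv.Perm.one_apply] at this
  exact this.symm

end Base

end RootPairing

/-! ### Independent subspaces and eigenspaces. -/

section LinearAlgebra

variable {K V : Type*} [Field K] [AddCommGroup V] [Module K V]

/-- The dimension of a finite sum of independent subspaces is the sum of the dimensions. -/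
lemma iSupIndep.finrank_iSup_eq_sum [FiniteDimensional K V] {ι : Type*} [Fintype ι]
    {W : ι → Submodule K V} (hW : iSupIndep W) :
    Module.finrank K ↥(⨆ i, W i) = ∑ i, Module.finrank K (W i) := by
  classical
  rw [Submodule.iSup_eq_range_dfinsupp_lsum,
    LinearMap.finrank_range_of_inj hW.dfinsupp_lsum_injective]
  exact Module.finrank_directSum (R := K) fun i ↦ W i

lemma iSupIndep.sum_finrank_le [FiniteDimensional K V] {ι : Type*} [Fintype ι]
    {W : ι → Submodule K V} (hW : iSupIndep W) {U : Submodule K V} (hU : ∀ i, W i ≤ U) :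
    ∑ i, Module.finrank K (W i) ≤ Module.finrank K U := by
  rw [← hW.finrank_iSup_eq_sum]
  exact Submodule.finrank_mono (iSup_le hU)

namespace Module.End

/-- The fixed space of an endomorphism acting by scalars on the members of a family of subspaces
spanning the whole space. -/
lemma eqLocus_one_eq_iSup {ι : Type*} (T : End K V) {W : ι → Submodule K V}
    (htop : ⨆ i, W i = ⊤) {c : ι → K} (hc : ∀ i, ∀ v ∈ W i, T v = c i • v) :
    LinearMap.eqLocus T (1 : End K V) = ⨆ i : {i // c i = 1}, W i := by
  apply le_antisymm
  · intro v hv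
    replace hv : T v = v := hv
    have hsup : (⨆ i : {i // c i = 1}, W i) ⊔ ⨆ i : {i // c i ≠ 1}, W i = ⊤ := by
      rw [eq_top_iff, ← htop]
      refine iSup_le fun i ↦ ?_
      by_cases hi : c i = 1
      · exact (le_iSup (fun i : {i // c i = 1} ↦ W i) ⟨i, hi⟩).trans le_sup_left
      · exact (le_iSup (fun i : {i // c i ≠ 1} ↦ W i) ⟨i, hi⟩).trans le_sup_right
    have hfix : ⨆ i : {i // c i = 1}, W i ≤ T.eigenspace 1 := iSup_le fun i w hw ↦ by
      rw [mem_eigenspace_iff, hc i w hw, i.2]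
    have hne : ⨆ i : {i // c i ≠ 1}, W i ≤ ⨆ (μ : K) (_ : μ ≠ 1), T.eigenspace μ :=
      iSup_le fun i ↦ le_iSup₂_of_le (c i) i.2 fun w hw ↦ mem_eigenspace_iff.mpr (hc i w hw)
    obtain ⟨a, ha, b, hb, rfl⟩ := Submodule.mem_sup.mp (hsup ▸ Submodule.mem_top (x := v))
    have hTa : T a = a := by simpa using mem_eigenspace_iff.mp (hfix ha)
    rw [map_add, hTa, add_right_inj] at hv
    have hb0 : b = 0 := by
      have hb1 : b ∈ T.eigenspace 1 := by rw [mem_eigenspace_iff, hv, one_smul]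
      exact Submodule.disjoint_def.mp (T.eigenspaces_iSupIndep 1) b hb1 (hne hb)
    rwa [hb0, add_zero]
  · refine iSup_le fun i w hw ↦ ?_
    rw [LinearMap.mem_eqLocus, hc i w hw, i.2, one_smul, one_apply]

/-- Some polynomial in an endomorphism acts by given scalars on its eigenspaces. -/
lemma exists_forall_apply_eq_smul [FiniteDimensional K V] (T : End K V) (g : K → K) :
    ∃ S : End K V, ∀ μ, ∀ v ∈ T.eigenspace μ, S v = g μ • v := by
  classical
  have hfin : {μ | T.eigenspace μ ≠ ⊥}.Finite :=
    WellFoundedGT.finite_ne_bot_of_iSupIndep T.eigenspaces_iSupIndep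
  refine ⟨Polynomial.aeval T (Lagrange.interpolate hfin.toFinset id g), fun μ v hv ↦ ?_⟩
  rcases eq_or_ne v 0 with rfl | hv0
  · simp
  have hμ : μ ∈ hfin.toFinset := by
    rw [Set.Finite.mem_toFinset]
    exact (Submodule.ne_bot_iff _).mpr ⟨v, hv, hv0⟩
  rw [aeval_apply_of_hasEigenvector ⟨hv, hv0⟩]
  have := Lagrange.eval_interpolate_at_node (v := id) g (Set.injOn_id _) hμ
  rw [id_eq] at this
  rw [this]

lemma maxGenEigenspace_neg (T : End K V) (μ : K) :
    (-T).maxGenEigenspace (-μ) = T.maxGenEigenspace μ := by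
  ext v
  rw [mem_maxGenEigenspace, mem_maxGenEigenspace]
  refine exists_congr fun k ↦ ?_
  have : -T - -μ • (1 : End K V) = -(T - μ • 1) := by rw [neg_smul]; abel
  rw [this, neg_pow, mul_apply]
  rcases neg_one_pow_eq_or (End K V) k with h | h <;> simp [h]

end Module.End

end LinearAlgebra

/-! ### Weight multiplicities of `sl₂`-modules. -/

namespace IsSl2Triple

open LieModule Module

variable {F L V : Type*} [Field F] [CharZero F] [LieRing L] [LieAlgebra F L]
  [AddCommGroup V] [Module F V] [LieRingModule L V] [LieModule F L V]
  {h e f : L}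

omit [CharZero F] in
lemma lie_e_mem_maxGenEigenspace (t : IsSl2Triple h e f) {μ : F} {v : V}
    (hv : v ∈ (toEnd F L V h).maxGenEigenspace μ) :
    ⁅e, v⁆ ∈ (toEnd F L V h).maxGenEigenspace (μ + 2) := by
  rw [add_comm]
  refine lie_mem_maxGenEigenspace_toEnd (End.eigenspace_le_maxGenEigenspace ?_) hv
  rw [End.mem_eigenspace_iff, toEnd_apply_apply, t.lie_h_e_smul F]

variable [FiniteDimensional F V]

/-- A nonzero generalized weight vector killed by `e` has a natural number as its weight. -/
lemma exists_nat_of_lie_e_eq_zero (t : IsSl2Triple h e f) {μ : F} {v : V}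
    (hv : v ∈ (toEnd F L V h).maxGenEigenspace μ) (hv0 : v ≠ 0) (hev : ⁅e, v⁆ = 0) :
    ∃ n : ℕ, μ = n := by
  obtain ⟨k, hk⟩ := (End.mem_maxGenEigenspace _ _ _).mp hv
  set T : End F V := toEnd F L V h - μ • 1
  have hT (w : V) : T w = ⁅h, w⁆ - μ • w := rfl
  have heT (n : ℕ) : ⁅e, (T ^ n) v⁆ = 0 := by
    induction n with
    | zero => simpa using hev
    | succ n ih =>
      rw [pow_succ', End.mul_apply, hT, lie_sub, lie_smul, ih, smul_zero, sub_zero,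
        leibniz_lie, ih, lie_zero, add_zero, ← lie_skew, t.lie_h_e_smul F, neg_lie, smul_lie, ih,
        smul_zero, neg_zero]
  -- The last nonzero vector among the `(T ^ n) v` is a genuine eigenvector still killed by `e`,
  -- that is, a primitive vector.
  obtain ⟨n, hn, hn'⟩ := Nat.exists_not_and_succ_of_not_zero_of_exists
    (p := fun n ↦ (T ^ n) v = 0) (by simpa using hv0) ⟨k, hk⟩
  rw [pow_succ', End.mul_apply, hT, sub_eq_zero] at hn'
  exact HasPrimitiveVectorWith.exists_nat (t := t) ⟨hn, hn', heT n⟩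

variable (V)

/-- Outside natural weights `e` is injective. Generalized eigenspaces are used because `h` is not
yet known to act semisimply. -/
lemma finrank_maxGenEigenspace_le_add_two (t : IsSl2Triple h e f) {μ : F} (hμ : ∀ n : ℕ, μ ≠ n) :
    finrank F ((toEnd F L V h).maxGenEigenspace μ) ≤
      finrank F ((toEnd F L V h).maxGenEigenspace (μ + 2)) := by
  refine LinearMap.finrank_le_finrank_of_injective
    (f := (toEnd F L V e).restrict fun v hv ↦ t.lie_e_mem_maxGenEigenspace hv) ?_
  rw [injective_iff_map_eq_zero]
  rintro ⟨v, hv⟩ h0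
  by_contra hne
  obtain ⟨n, hn⟩ := t.exists_nat_of_lie_e_eq_zero hv (by simpa using hne) (congrArg Subtype.val h0)
  exact hμ n hn

lemma finrank_maxGenEigenspace_le_sub_two (t : IsSl2Triple h e f) {μ : F} (hμ : ∀ n : ℕ, μ ≠ -n) :
    finrank F ((toEnd F L V h).maxGenEigenspace μ) ≤
      finrank F ((toEnd F L V h).maxGenEigenspace (μ - 2)) := by
  have := t.symm.finrank_maxGenEigenspace_le_add_two V (μ := -μ)
    fun n hn ↦ hμ n (by rw [← hn, neg_neg])
  rwa [map_neg, End.maxGenEigenspace_neg, show -μ + 2 = -(μ - 2) by ring,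
    End.maxGenEigenspace_neg] at this

omit [CharZero F] in
/-- Only finitely many members of a family of distinct generalized weight spaces are nonzero. -/
lemma exists_finrank_maxGenEigenspace_eq_zero (T : End F V) (g : ℕ → F)
    (hg : Function.Injective g) :
    ∃ N, ∀ n, N ≤ n → finrank F (T.maxGenEigenspace (g n)) = 0 := by
  have hfin : {n | T.maxGenEigenspace (g n) ≠ ⊥}.Finite :=
    WellFoundedGT.finite_ne_bot_of_iSupIndep (T.independent_maxGenEigenspace.comp hg)
  obtain ⟨N, hN⟩ := hfin.bddAbove
  refine ⟨N + 1, fun n hn ↦ ?_⟩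
  by_contra hne
  have : n ≤ N := hN fun h0 ↦ hne (by rw [h0, finrank_bot])
  omega

/-- The number of irreducible constituents of an `sl₂`-module is at least the sum of the dimensions
of the (generalized) weight spaces for the weights zero and one. -/
lemma finrank_add_finrank_le_finrank_ker (t : IsSl2Triple h e f) :
    finrank F ((toEnd F L V h).maxGenEigenspace 0) +
      finrank F ((toEnd F L V h).maxGenEigenspace 1) ≤
        finrank F (LinearMap.ker (toEnd F L V e)) := by
  set D : ℕ → ℕ := fun n ↦ finrank F ((toEnd F L V h).maxGenEigenspace (n : F)) with hD
  let W (n : ℕ) : Submodule F V :=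
    LinearMap.ker (toEnd F L V e) ⊓ (toEnd F L V h).maxGenEigenspace (n : F)
  -- Rank–nullity for `e` from weight `n` to weight `n + 2`. Summation telescopes along each parity
  -- and leaves the weights 0 and 1.
  have hstep (n : ℕ) : D n ≤ finrank F (W n) + D (n + 2) := by
    let φ : (toEnd F L V h).maxGenEigenspace (n : F) →ₗ[F]
        (toEnd F L V h).maxGenEigenspace ((n : F) + 2) :=
      (toEnd F L V e).restrict fun v hv ↦ t.lie_e_mem_maxGenEigenspace hv
    have h1 := φ.finrank_range_add_finrank_ker
    have h2 : finrank F φ.range ≤ D (n + 2) := by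
      rw [hD]
      dsimp only
      rw [Nat.cast_add, Nat.cast_ofNat]
      exact Submodule.finrank_le _
    have h3 : finrank F φ.ker ≤ finrank F (W n) := by
      refine (Submodule.equivMapOfInjective _ (Submodule.subtype_injective _)
        φ.ker).finrank_eq.trans_le (Submodule.finrank_mono ?_)
      rintro _ ⟨x, hx, rfl⟩
      exact ⟨congrArg Subtype.val hx, x.2⟩
    have h4 : D n = finrank F ((toEnd F L V h).maxGenEigenspace (n : F)) := rfl
    omega
  have hsum (N : ℕ) : D 0 + D 1 ≤ ∑ n ∈ Finset.range N, finrank F (W n) + D N + D (N + 1) := by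
    induction N with
    | zero => simp
    | succ N ih =>
      rw [Finset.sum_range_succ]
      have := hstep N
      rw [show N + 1 + 1 = N + 2 from rfl]
      omega
  obtain ⟨N, hN⟩ := exists_finrank_maxGenEigenspace_eq_zero V (toEnd F L V h) (fun n ↦ (n : F))
    Nat.cast_injective
  have h1 := hsum N
  rw [show D N = 0 from hN N le_rfl, show D (N + 1) = 0 from hN (N + 1) N.le_succ] at h1
  have hind : iSupIndep fun n : Fin N ↦ W n :=
    ((toEnd F L V h).independent_maxGenEigenspace.comp
      (f := fun n : Fin N ↦ ((n : ℕ) : F))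
      (Nat.cast_injective.comp Fin.val_injective)).mono fun n ↦ inf_le_right
  have h2 := hind.sum_finrank_le (U := LinearMap.ker (toEnd F L V e)) fun n ↦ inf_le_left
  rw [Fin.sum_univ_eq_sum_range (fun n ↦ finrank F (W n))] at h2
  have h3 : D 0 = finrank F ((toEnd F L V h).maxGenEigenspace 0) := by
    rw [hD]
    dsimp only
    rw [Nat.cast_zero]
  have h4 : D 1 = finrank F ((toEnd F L V h).maxGenEigenspace 1) := by
    rw [hD]
    dsimp only
    rw [Nat.cast_one]
  omega

end IsSl2Triple

/-! ### Exponentials and the action of the torus on the grading. -/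

namespace PrincipalAutomorphism

open Module

section ExpAd

variable {F L : Type*} [Field F] [LieRing L] [LieAlgebra F L] [FiniteDimensional F L]

lemma pow_finrank_eq_zero_of_isNilpotent {V : Type*} [AddCommGroup V] [Module F V]
    [FiniteDimensional F V] {T : End F V} (hT : IsNilpotent T) : T ^ finrank F V = 0 := by
  have := T.aeval_self_charpoly
  rwa [IsNilpotent.charpoly_eq_X_pow_finrank hT, map_pow, Polynomial.aeval_X] at this

lemma expAd_apply_eq_sum {x : L} (hx : IsNilpotent (LieAlgebra.ad F L x)) {y : L} {n : ℕ}
    (hn : (LieAlgebra.ad F L x ^ n) y = 0) :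
    expAd F x y = ∑ k ∈ Finset.range n, (k.factorial : F)⁻¹ • (LieAlgebra.ad F L x ^ k) y := by
  have key (m : ℕ) (hm : (LieAlgebra.ad F L x ^ m) y = 0) (N : ℕ) :
      ∑ k ∈ Finset.range (m + N), (k.factorial : F)⁻¹ • (LieAlgebra.ad F L x ^ k) y =
        ∑ k ∈ Finset.range m, (k.factorial : F)⁻¹ • (LieAlgebra.ad F L x ^ k) y := by
    rw [Finset.sum_range_add, add_eq_left]
    refine Finset.sum_eq_zero fun k _ ↦ ?_
    rw [Module.End.pow_map_zero_of_le (Nat.le_add_right m k) hm, smul_zero]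
  have h0 : (LieAlgebra.ad F L x ^ finrank F L) y = 0 := by
    rw [pow_finrank_eq_zero_of_isNilpotent hx, LinearMap.zero_apply]
  rw [← key n hn (finrank F L), add_comm, key _ h0]
  simp [expAd, LinearMap.sum_apply]

variable [CharZero F]

lemma expAd_eq_exp [Module ℚ L] {x : L} (hx : IsNilpotent (LieAlgebra.ad F L x)) :
    expAd F x = IsNilpotent.exp (LieAlgebra.ad F L x : End F L) := by
  rw [IsNilpotent.exp_eq_sum (pow_finrank_eq_zero_of_isNilpotent hx), expAd]
  refine Finset.sum_congr rfl fun k _ ↦ LinearMap.ext fun y ↦ ?_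
  rw [LinearMap.smul_apply, LinearMap.smul_apply, ← Rat.cast_smul_eq_qsmul F, Rat.cast_inv,
    Rat.cast_natCast]

lemma expAd_mul_expAd_neg {x : L} (hx : IsNilpotent (LieAlgebra.ad F L x)) :
    expAd F x * expAd F (-x) = 1 := by
  let : Module ℚ L := Module.compHom L (algebraMap ℚ F)
  rw [expAd_eq_exp hx, expAd_eq_exp (by rw [map_neg]; exact hx.neg), map_neg,
    hx.exp_mul_exp_neg_self]

lemma expAd_lie {x : L} (hx : IsNilpotent (LieAlgebra.ad F L x)) (y z : L) :
    expAd F x ⁅y, z⁆ = ⁅expAd F x y, expAd F x z⁆ := by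
  let : Module ℚ L := Module.compHom L (algebraMap ℚ F)
  let : LieAlgebra ℚ L := { lie_smul := fun q y z ↦ lie_smul (algebraMap ℚ F q) y z }
  have hD : (LieDerivation.ad F L x).toLinearMap = LieAlgebra.ad F L x := by ext; simp
  have := LieHom.map_lie (LieDerivation.exp (LieDerivation.ad F L x) (by rwa [hD])).toLieHom y z
  simp only [LieEquiv.coe_toLieHom, LieDerivation.exp_map_apply, hD] at this
  rw [expAd_eq_exp hx, this]

end ExpAd

section Torus

variable {F L : Type*} [Field F] [CharZero F] [LieRing L] [LieAlgebra F L] [FiniteDimensional F L]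
  {h e f : L}

/-- The eigenspace of `ad h` for the eigenvalue `2 * j`. -/
noncomputable def gradedPiece (F : Type*) {L : Type*} [Field F] [LieRing L] [LieAlgebra F L]
    (h : L) (j : ℤ) : Submodule F L :=
  (LieAlgebra.ad F L h : End F L).eigenspace (2 * j : F)

omit [CharZero F] [FiniteDimensional F L] in
lemma mem_gradedPiece {j : ℤ} {v : L} : v ∈ gradedPiece F h j ↔ ⁅h, v⁆ = (2 * j : F) • v := by
  rw [gradedPiece, End.mem_eigenspace_iff, LieAlgebra.ad_apply]

omit [CharZero F] [FiniteDimensional F L] in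
lemma gradedPiece_neg (j : ℤ) : gradedPiece F (-h) j = gradedPiece F h (-j) := by
  ext v
  rw [mem_gradedPiece, mem_gradedPiece, neg_lie, neg_eq_iff_eq_neg, ← neg_smul]
  push_cast
  rw [mul_neg]

omit [FiniteDimensional F L] in
lemma two_mul_intCast_injective : Function.Injective fun j : ℤ ↦ (2 * j : F) := fun i j hij ↦ by
  simpa using hij

omit [FiniteDimensional F L] in
lemma iSupIndep_gradedPiece : iSupIndep (gradedPiece F h) :=
  (LieAlgebra.ad F L h : End F L).eigenspaces_iSupIndep.comp two_mul_intCast_injective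

omit [CharZero F] [FiniteDimensional F L] in
lemma lie_e_mem_gradedPiece (t : IsSl2Triple h e f) {j : ℤ} {v : L} (hv : v ∈ gradedPiece F h j) :
    ⁅e, v⁆ ∈ gradedPiece F h (j + 1) := by
  rw [mem_gradedPiece] at hv ⊢
  rw [leibniz_lie, hv, t.lie_h_e_smul F, smul_lie, lie_smul, ← add_smul]
  push_cast
  congr 1
  ring

variable (htop : ⨆ j, gradedPiece F h j = ⊤)

include htop

/-- `e` raises the degree by one, and only finitely many degrees occur. -/
lemma isNilpotent_ad_of_iSup_gradedPiece_eq_top (t : IsSl2Triple h e f) :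
    IsNilpotent (LieAlgebra.ad F L e) := by
  have hfin : {j : ℤ | gradedPiece F h j ≠ ⊥}.Finite :=
    WellFoundedGT.finite_ne_bot_of_iSupIndep iSupIndep_gradedPiece
  obtain ⟨B, hB⟩ := hfin.bddAbove
  obtain ⟨A, hA⟩ := hfin.bddBelow
  refine ⟨(B - A + 1).toNat, ?_⟩
  have hpow (k : ℕ) (j : ℤ) (v : L) (hv : v ∈ gradedPiece F h j) :
      (LieAlgebra.ad F L e ^ k) v ∈ gradedPiece F h (j + k) := by
    induction k with
    | zero => simpa using hv
    | succ k ih =>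
      rw [pow_succ', End.mul_apply]
      have := lie_e_mem_gradedPiece t ih
      push_cast
      rwa [← add_assoc]
  rw [← LinearMap.ker_eq_top, eq_top_iff, ← htop]
  refine iSup_le fun j v hv ↦ ?_
  rw [LinearMap.mem_ker]
  by_cases hj : gradedPiece F h j = ⊥
  · rw [hj, Submodule.mem_bot] at hv
    rw [hv, map_zero]
  · have h1 : A ≤ j := hA hj
    have h2 := hpow (B - A + 1).toNat j v hv
    have h3 : gradedPiece F h (j + (B - A + 1).toNat) = ⊥ := by
      by_contra hne
      have : j + (B - A + 1).toNat ≤ B := hB hne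
      omega
    rwa [h3, Submodule.mem_bot] at h2

lemma isNilpotent_ad_smul_e (t : IsSl2Triple h e f) (u : F) :
    IsNilpotent (LieAlgebra.ad F L (u • e)) := by
  rw [map_smul]
  exact (isNilpotent_ad_of_iSup_gradedPiece_eq_top htop t).smul u

lemma isNilpotent_ad_smul_f (t : IsSl2Triple h e f) (u : F) :
    IsNilpotent (LieAlgebra.ad F L (u • f)) := by
  refine isNilpotent_ad_smul_e (h := -h) ?_ t.symm u
  rw [← htop]
  simp_rw [gradedPiece_neg]
  exact (Equiv.neg ℤ).iSup_comp (g := gradedPiece F h)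

lemma weylAd_mul_weylAd_neg (t : IsSl2Triple h e f) :
    weylAd e f (1 : F) * weylAd e f (-1 : F) = 1 := by
  have h1 := expAd_mul_expAd_neg (isNilpotent_ad_smul_e htop t (1 : F))
  have h2 := expAd_mul_expAd_neg (isNilpotent_ad_smul_f htop t (-(1 : F)⁻¹))
  have h3 : weylAd e f (-1 : F) =
      expAd F (-((1 : F) • e)) * expAd F (-(-(1 : F)⁻¹ • f)) * expAd F (-((1 : F) • e)) := by
    simp [weylAd]
  have h4 (a a' b b' : End F L) (ha : a * a' = 1) (hb : b * b' = 1) :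
      a * b * a * (a' * b' * a') = 1 := by
    rw [mul_assoc (a * b), ← mul_assoc a, ← mul_assoc a, ha, one_mul, mul_assoc a, ← mul_assoc b,
      hb, one_mul, ha]
  rw [h3, weylAd, h4 _ _ _ _ h1 h2]

lemma weylAd_lie (t : IsSl2Triple h e f) (u : F) (y z : L) :
    weylAd e f u ⁅y, z⁆ = ⁅weylAd e f u y, weylAd e f u z⁆ := by
  simp only [weylAd, End.mul_apply, expAd_lie (isNilpotent_ad_smul_e htop t _),
    expAd_lie (isNilpotent_ad_smul_f htop t _)]

lemma weylAd_neg_one_apply_h (t : IsSl2Triple h e f) : weylAd e f (-1 : F) h = -h := by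
  have hhe := t.lie_h_e_smul F
  have hhf := t.lie_lie_smul_f F
  have heh : ⁅e, h⁆ = -((2 : F) • e) := by rw [← lie_skew, hhe]
  have hfh : ⁅f, h⁆ = (2 : F) • f := by rw [← lie_skew, hhf, neg_neg]
  have hfe : ⁅f, e⁆ = -h := by rw [← lie_skew, t.lie_e_f]
  have h1 : expAd F ((-1 : F) • e) h = h + (2 : F) • e := by
    rw [expAd_apply_eq_sum (isNilpotent_ad_smul_e htop t _) (n := 2)]
    · simp [Finset.sum_range_succ, heh]
    · simp [pow_succ, heh]
  have h2 : expAd F ((1 : F) • f) (h + (2 : F) • e) = -h + (2 : F) • e := by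
    rw [expAd_apply_eq_sum (isNilpotent_ad_smul_f htop t _) (n := 3)]
    · simp only [Finset.sum_range_succ, Finset.sum_range_zero, pow_succ, pow_zero, one_mul,
        End.mul_apply, End.one_apply, LieAlgebra.ad_apply, one_smul, lie_add, lie_smul, hfh, hfe,
        lie_neg, lie_self, smul_zero, Nat.factorial, Nat.cast_one, inv_one]
      module
    · simp [pow_succ, hfh, hfe]
  have h3 : expAd F ((-1 : F) • e) (-h + (2 : F) • e) = -h := by
    rw [expAd_apply_eq_sum (isNilpotent_ad_smul_e htop t _) (n := 2)]
    · simp [Finset.sum_range_succ, heh]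
    · simp [pow_succ, heh]
  rw [weylAd, inv_neg, inv_one, neg_neg, End.mul_apply, End.mul_apply, h1, h2, h3]

/-- The Weyl element respects brackets and negates `h`, so it reverses the grading. -/
lemma weylAd_neg_one_mem_gradedPiece (t : IsSl2Triple h e f) {j : ℤ} {v : L}
    (hv : v ∈ gradedPiece F h j) : weylAd e f (-1 : F) v ∈ gradedPiece F h (-j) := by
  rw [mem_gradedPiece] at hv ⊢
  have := weylAd_lie htop t (-1) h v
  rw [hv, weylAd_neg_one_apply_h htop t, map_smul, neg_lie, eq_comm, neg_eq_iff_eq_neg] at this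
  rw [this, Int.cast_neg, mul_neg, neg_smul]

lemma gradedPiece_neg_eq_bot (t : IsSl2Triple h e f) {j : ℤ} (hj : gradedPiece F h j = ⊥) :
    gradedPiece F h (-j) = ⊥ := by
  rw [eq_bot_iff]
  intro v hv
  have h1 := weylAd_neg_one_mem_gradedPiece htop t hv
  rw [neg_neg, hj, Submodule.mem_bot] at h1
  have h2 := LinearMap.congr_fun (weylAd_mul_weylAd_neg htop t) v
  rw [End.mul_apply, h1, map_zero, End.one_apply] at h2
  exact h2.symm

lemma torusAd_apply_of_mem_gradedPiece [IsAlgClosed F] (t : IsSl2Triple h e f) {u : F} (hu : u ≠ 0)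
    (j : ℤ) {v : L} (hv : v ∈ gradedPiece F h j) : torusAd e f u v = u ^ (2 * j) • v := by
  -- Write `w` for `weylAd e f`. With `δ` the action of `diag(s, s⁻¹)` one has `δ w(1) δ⁻¹ = w(s²)`,
  -- so the torus element is the commutator of `δ` and `w(1)`. As `w` reverses degrees, both factors
  -- `δ` and `δ⁻¹` contribute `s ^ (2j)`, in total `s ^ (4j) = (s ^ 2) ^ (2j)`.
  obtain ⟨s, rfl⟩ := IsAlgClosed.exists_pow_nat_eq u two_pos
  have hs : s ≠ 0 := fun h0 ↦ hu (by simp [h0])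
  -- The operator `δ` is the action of `diag(s, s⁻¹)`, defined by its weights.
  obtain ⟨δ, hδ'⟩ := (LieAlgebra.ad F L h : End F L).exists_forall_apply_eq_smul
    (fun μ ↦ s ^ (2 * Function.invFun (fun j : ℤ ↦ (2 * j : F)) μ))
  have hδ (i : ℤ) (w : L) (hw : w ∈ gradedPiece F h i) : δ w = s ^ (2 * i) • w := by
    have := hδ' _ w hw
    rwa [Function.leftInverse_invFun two_mul_intCast_injective i] at this
  have hext (A B : End F L) (hAB : ∀ i, ∀ w ∈ gradedPiece F h i, A w = B w) : A = B := by
    have : (⊤ : Submodule F L) ≤ LinearMap.eqLocus A B := by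
      rw [← htop]
      exact iSup_le fun i w hw ↦ hAB i w hw
    exact LinearMap.ext fun w ↦ this Submodule.mem_top
  have hexp (x y : L) (hxy : SemiconjBy δ (LieAlgebra.ad F L x : End F L) (LieAlgebra.ad F L y)) :
      SemiconjBy δ (expAd F x) (expAd F y) := by
    rw [SemiconjBy, expAd, expAd, Finset.mul_sum, Finset.sum_mul]
    refine Finset.sum_congr rfl fun k _ ↦ ?_
    rw [mul_smul_comm, smul_mul_assoc, (hxy.pow_right k).eq]
  have hδe (a : F) : SemiconjBy δ (expAd F (a • e)) (expAd F ((s ^ 2 * a) • e)) := by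
    refine hexp _ _ (hext _ _ fun i w hw ↦ ?_)
    rw [End.mul_apply, End.mul_apply, hδ i w hw, LieAlgebra.ad_apply, LieAlgebra.ad_apply, smul_lie,
      smul_lie, map_smul, hδ _ _ (lie_e_mem_gradedPiece t hw), lie_smul, smul_smul, smul_smul,
      show 2 * (i + 1) = 2 * i + 2 by ring, zpow_add₀ hs, zpow_ofNat]
    congr 1
    ring
  have hδf (a : F) : SemiconjBy δ (expAd F (a • f)) (expAd F (((s ^ 2)⁻¹ * a) • f)) := by
    refine hexp _ _ (hext _ _ fun i w hw ↦ ?_)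
    have hfw : ⁅f, w⁆ ∈ gradedPiece F h (i - 1) := by
      rw [← neg_neg i, ← gradedPiece_neg] at hw
      have := lie_e_mem_gradedPiece t.symm hw
      rwa [gradedPiece_neg, neg_add, neg_neg, ← sub_eq_add_neg] at this
    rw [End.mul_apply, End.mul_apply, hδ i w hw, LieAlgebra.ad_apply, LieAlgebra.ad_apply, smul_lie,
      smul_lie, map_smul, hδ _ _ hfw, lie_smul, smul_smul, smul_smul,
      show 2 * (i - 1) = 2 * i - 2 by ring, zpow_sub₀ hs, zpow_ofNat]
    congr 1
    field_simp
  have hweyl : δ * weylAd e f (1 : F) = weylAd e f (s ^ 2) * δ := by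
    have h1 := hδe 1
    have h2 := hδf (-(1 : F)⁻¹)
    have h3 := (h1.mul_right h2).mul_right h1
    rw [inv_one, mul_one, mul_neg_one] at h3
    rw [weylAd, weylAd, inv_one]
    exact h3
  have hw := weylAd_neg_one_mem_gradedPiece htop t hv
  have h4 : weylAd e f (-1 : F) v = s ^ (2 * j) • δ (weylAd e f (-1 : F) v) := by
    rw [hδ _ _ hw, smul_smul, ← zpow_add₀ hs, mul_neg, add_neg_cancel, zpow_zero, one_smul]
  have h5 : weylAd e f (1 : F) (weylAd e f (-1 : F) v) = v := by
    rw [← End.mul_apply, weylAd_mul_weylAd_neg htop t, End.one_apply]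
  rw [torusAd, End.mul_apply, h4, map_smul, ← End.mul_apply, ← hweyl, End.mul_apply, h5, hδ j v hv,
    smul_smul, ← zpow_add₀ hs, ← zpow_natCast, ← zpow_mul]
  congr 2
  push_cast
  ring

end Torus

end PrincipalAutomorphism

/-! ### Consequences of principality, and the two comparisons of fixed spaces. -/

section

open Module LieModule

/-- If the Engel subalgebra of `x` has dimension equal to the rank, it is a Cartan subalgebra. -/
lemma LieAlgebra.isCartanSubalgebra_engel_of_finrank_eq_rank {K L : Type*} [Field K] [Infinite K]
    [LieRing L] [LieAlgebra K L] [FiniteDimensional K L] {x : L}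
    (hx : finrank K (LieSubalgebra.engel K x) = rank K L) :
    (LieSubalgebra.engel K x).IsCartanSubalgebra := by
  refine ⟨LieSubalgebra.isNilpotent_of_forall_le_engel _ fun y hy ↦ ?_,
    LieSubalgebra.normalizer_engel _ _⟩
  let Ex : {LieSubalgebra.engel K z | z ∈ LieSubalgebra.engel K x} :=
    ⟨LieSubalgebra.engel K x, x, LieSubalgebra.self_mem_engel _ _, rfl⟩
  -- No Engel subalgebra has dimension below the rank, so this one is minimal among those of its own
  -- elements, and over an infinite field minimal implies least.
  suffices IsBot Ex from @this ⟨LieSubalgebra.engel K y, y, hy, rfl⟩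
  refine engel_isBot_of_isMin (Cardinal.natCast_le_aleph0.trans <|
    Cardinal.infinite_iff.mp ‹Infinite K›) (LieSubalgebra.engel K x) Ex le_rfl ?_
  rintro ⟨_, y, hy, rfl⟩ hyx
  suffices finrank K (LieSubalgebra.engel K x) ≤ finrank K (LieSubalgebra.engel K y) by
    suffices LieSubalgebra.engel K y = LieSubalgebra.engel K x from this.ge
    apply LieSubalgebra.toSubmodule_injective
    exact Submodule.eq_of_le_of_finrank_le hyx this
  rw [hx]
  exact rank_le_finrank_engel K y

namespace IsSl2Triple

variable {F L : Type*} (V : Type*) [Field F] [CharZero F] [LieRing L] [LieAlgebra F L]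
  [AddCommGroup V] [Module F V] [LieRingModule L V] [LieModule F L V] [FiniteDimensional F V]
  {h e f : L}

/-- On positive weights `f` is injective, so each step of two down towards `i` cannot lower the
dimension. -/
lemma finrank_maxGenEigenspace_add_le (t : IsSl2Triple h e f) (i k : ℕ) {μ ν : F} (hμ : μ = i)
    (hν : ν = i + 2 * k) :
    finrank F ((toEnd F L V h).maxGenEigenspace ν) ≤
      finrank F ((toEnd F L V h).maxGenEigenspace μ) := by
  induction k generalizing ν with
  | zero => rw [show ν = μ by rw [hν, hμ, Nat.cast_zero, mul_zero, add_zero]]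
  | succ k ih =>
    refine le_trans ?_ (ih rfl)
    have := t.finrank_maxGenEigenspace_le_sub_two V (μ := ν) fun n hn ↦ by
      have h1 : ((i + 2 * (k + 1) + n : ℕ) : F) = 0 := by
        push_cast
        push_cast at hν
        rw [← hν, hn, neg_add_cancel]
      have := Nat.cast_eq_zero.mp h1
      omega
    rwa [show ν - 2 = i + 2 * k by rw [hν]; push_cast; ring] at this

lemma finrank_maxGenEigenspace_neg_le (t : IsSl2Triple h e f) (i k : ℕ) {μ ν : F} (hμ : μ = -i)
    (hν : ν = -(i + 2 * k)) :
    finrank F ((toEnd F L V h).maxGenEigenspace ν) ≤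
      finrank F ((toEnd F L V h).maxGenEigenspace μ) := by
  have := t.symm.finrank_maxGenEigenspace_add_le V (F := F) i k (μ := -μ) (ν := -ν)
    (by rw [hμ, neg_neg]) (by rw [hν, neg_neg])
  rwa [map_neg, End.maxGenEigenspace_neg, End.maxGenEigenspace_neg] at this

/-- The dimensions of the even weight spaces decrease away from zero. -/
lemma finrank_maxGenEigenspace_two_mul_le (t : IsSl2Triple h e f) {i j : ℤ}
    (hij : (0 ≤ i ∧ i ≤ j) ∨ (j ≤ i ∧ i ≤ 0)) :
    finrank F ((toEnd F L V h).maxGenEigenspace (2 * j : F)) ≤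
      finrank F ((toEnd F L V h).maxGenEigenspace (2 * i : F)) := by
  rcases hij with ⟨hi, hij⟩ | ⟨hij, hi⟩
  · obtain ⟨a, rfl⟩ := Int.eq_ofNat_of_zero_le hi
    obtain ⟨k, rfl⟩ := Int.le.dest hij
    exact t.finrank_maxGenEigenspace_add_le V (2 * a) k (by push_cast; ring) (by push_cast; ring)
  · obtain ⟨a, ha⟩ := Int.eq_ofNat_of_zero_le (neg_nonneg.mpr hi)
    obtain rfl : i = -a := by omega
    obtain ⟨k, hk⟩ := Int.le.dest hij
    obtain rfl : j = -a - k := by omega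
    exact t.finrank_maxGenEigenspace_neg_le V (2 * a) k (by push_cast; ring) (by push_cast; ring)

/-- A nonzero generalized weight is an integer. -/
lemma exists_int_of_maxGenEigenspace_ne_bot (t : IsSl2Triple h e f) {μ : F}
    (hμ : (toEnd F L V h).maxGenEigenspace μ ≠ ⊥) : ∃ k : ℤ, μ = k := by
  by_contra! hcon
  -- For a non-integral weight `e` would be injective along all of `μ + 2ℕ`, where only finitely
  -- many weight spaces are nonzero.
  have h0 (n : ℕ) : finrank F ((toEnd F L V h).maxGenEigenspace μ) ≤
      finrank F ((toEnd F L V h).maxGenEigenspace (μ + 2 * n)) := by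
    induction n with
    | zero => rw [Nat.cast_zero, mul_zero, add_zero]
    | succ n ih =>
      refine ih.trans ?_
      have := t.finrank_maxGenEigenspace_le_add_two V (μ := μ + 2 * n) fun k hk ↦
        hcon (k - 2 * n) (by push_cast; rw [← hk]; ring)
      rwa [show μ + 2 * n + 2 = μ + 2 * (n + 1 : ℕ) by push_cast; ring] at this
  obtain ⟨N, hN⟩ := exists_finrank_maxGenEigenspace_eq_zero V (toEnd F L V h)
    (fun n : ℕ ↦ μ + 2 * n) (fun a b hab ↦ by simpa using hab)
  have h1 := h0 N
  rw [hN N le_rfl, Nat.le_zero, Submodule.finrank_eq_zero] at h1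
  exact hμ h1

/-- If the weight one does not occur then all weights are even. -/
lemma exists_two_mul_of_maxGenEigenspace_ne_bot (t : IsSl2Triple h e f)
    (h1 : finrank F ((toEnd F L V h).maxGenEigenspace 1) = 0) {μ : F}
    (hμ : (toEnd F L V h).maxGenEigenspace μ ≠ ⊥) : ∃ j : ℤ, μ = 2 * j := by
  obtain ⟨k, rfl⟩ := t.exists_int_of_maxGenEigenspace_ne_bot V hμ
  rcases Int.even_or_odd' k with ⟨j, rfl | rfl⟩
  · exact ⟨j, by push_cast; rfl⟩
  exfalso
  rw [ne_eq, ← Submodule.finrank_eq_zero (R := F)] at hμ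
  refine hμ (Nat.le_zero.mp ?_)
  rcases le_or_gt 0 j with hj | hj
  · obtain ⟨a, rfl⟩ := Int.eq_ofNat_of_zero_le hj
    rw [← h1]
    exact t.finrank_maxGenEigenspace_add_le V 1 a (by push_cast; ring) (by push_cast; ring)
  · obtain ⟨a, ha⟩ := Int.eq_ofNat_of_zero_le (show 0 ≤ -j - 1 by omega)
    obtain rfl : j = -a - 1 := by omega
    -- `e` is injective on weight `-1`, so that weight vanishes together with weight 1.
    have h3 := t.finrank_maxGenEigenspace_le_add_two V (μ := (-1 : F)) fun n hn ↦ by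
      have : ((n + 1 : ℕ) : F) = 0 := by push_cast; rw [← hn, neg_add_cancel]
      exact Nat.cast_ne_zero.mpr n.succ_ne_zero this
    rw [show (-1 + 2 : F) = 1 by ring, h1] at h3
    exact (t.finrank_maxGenEigenspace_neg_le V 1 a (by push_cast; ring)
      (by push_cast; ring)).trans h3

end IsSl2Triple

namespace PrincipalAutomorphism

open LieAlgebra

namespace IsPrincipalSl2Triple

variable {F L : Type*} [Field F] [CharZero F] [LieRing L] [LieAlgebra F L] [FiniteDimensional F L]
  {h e f : L} (hp : IsPrincipalSl2Triple F h e f)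

include hp

lemma finrank_add_finrank_le_rank :
    finrank F ((toEnd F L L h).maxGenEigenspace 0) +
      finrank F ((toEnd F L L h).maxGenEigenspace 1) ≤ LieAlgebra.rank F L := by
  rw [← hp.finrank_centralizer]
  exact hp.isSl2Triple.finrank_add_finrank_le_finrank_ker L

/-- The generalized null space of `ad h` is an Engel subalgebra, so it already uses up the rank and
leaves nothing for weight 1. -/
lemma finrank_maxGenEigenspace_one : finrank F ((toEnd F L L h).maxGenEigenspace 1) = 0 := by
  have h1 := hp.finrank_add_finrank_le_rank
  have h2 : LieAlgebra.rank F L ≤ finrank F ((toEnd F L L h).maxGenEigenspace 0) :=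
    rank_le_finrank_engel F h
  omega

lemma isCartanSubalgebra_engel : (LieSubalgebra.engel F h).IsCartanSubalgebra := by
  refine isCartanSubalgebra_engel_of_finrank_eq_rank (le_antisymm ?_ (rank_le_finrank_engel F h))
  exact (Nat.le_add_right _ _).trans hp.finrank_add_finrank_le_rank

lemma isSemisimple_ad [IsKilling F L] [IsAlgClosed F] : (LieAlgebra.ad F L h).IsSemisimple := by
  have := hp.isCartanSubalgebra_engel
  exact IsKilling.isSemisimple_ad_of_mem_isCartanSubalgebra (LieSubalgebra.self_mem_engel F h)

variable [IsKilling F L] [IsAlgClosed F]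

lemma gradedPiece_eq_maxGenEigenspace (j : ℤ) :
    gradedPiece F h j = (toEnd F L L h).maxGenEigenspace (2 * j : F) :=
  (hp.isSemisimple_ad.isFinitelySemisimple.maxGenEigenspace_eq_eigenspace _).symm

lemma iSup_gradedPiece_eq_top : ⨆ j, gradedPiece F h j = ⊤ := by
  rw [eq_top_iff, ← (toEnd F L L h).iSup_maxGenEigenspace_eq_top]
  refine iSup_le fun μ ↦ ?_
  by_cases hμ : (toEnd F L L h).maxGenEigenspace μ = ⊥
  · rw [hμ]
    exact bot_le
  · obtain ⟨j, rfl⟩ := hp.isSl2Triple.exists_two_mul_of_maxGenEigenspace_ne_bot L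
      hp.finrank_maxGenEigenspace_one hμ
    rw [← hp.gradedPiece_eq_maxGenEigenspace]
    exact le_iSup (gradedPiece F h) j

lemma finrank_gradedPiece_le {i j : ℤ} (hij : (0 ≤ i ∧ i ≤ j) ∨ (j ≤ i ∧ i ≤ 0)) :
    finrank F (gradedPiece F h j) ≤ finrank F (gradedPiece F h i) := by
  rw [hp.gradedPiece_eq_maxGenEigenspace, hp.gradedPiece_eq_maxGenEigenspace]
  exact hp.isSl2Triple.finrank_maxGenEigenspace_two_mul_le L hij

lemma eqLocus_torusAd_eq_iSup {m : ℕ} (hm : 0 < m) {ζ : F} (hζ : IsPrimitiveRoot ζ (2 * m)) :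
    LinearMap.eqLocus (torusAd e f ζ) (1 : End F L) =
      ⨆ j : {j : ℤ // (m : ℤ) ∣ j}, gradedPiece F h j := by
  rw [(torusAd e f ζ).eqLocus_one_eq_iSup hp.iSup_gradedPiece_eq_top fun j v hv ↦
    torusAd_apply_of_mem_gradedPiece hp.iSup_gradedPiece_eq_top hp.isSl2Triple
      (hζ.ne_zero (by omega)) j hv]
  have hiff (j : ℤ) : ζ ^ (2 * j) = 1 ↔ (m : ℤ) ∣ j := by
    rw [hζ.zpow_eq_one_iff_dvd]
    push_cast
    exact mul_dvd_mul_iff_left two_ne_zero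
  exact (Equiv.subtypeEquivRight hiff).iSup_congr fun _ ↦ rfl

lemma eqLocus_torusAd_eq_iSup_mul {m : ℕ} (hm : 0 < m) {ζ : F} (hζ : IsPrimitiveRoot ζ (2 * m)) :
    LinearMap.eqLocus (torusAd e f ζ) (1 : End F L) = ⨆ i : ℤ, gradedPiece F h (m * i) := by
  rw [hp.eqLocus_torusAd_eq_iSup hm hζ]
  refine le_antisymm (iSup_le ?_) (iSup_le fun i ↦ ?_)
  · rintro ⟨_, i, rfl⟩
    exact le_iSup (fun i : ℤ ↦ gradedPiece F h (m * i)) i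
  · exact le_iSup (fun j : {j : ℤ // (m : ℤ) ∣ j} ↦ gradedPiece F h j) ⟨m * i, dvd_mul_right _ _⟩

/-- The dimension of the fixed subalgebra is the sum of the dimensions of the graded pieces whose
degree is a multiple of `m`. -/
lemma fixedDim_eq_sum {m : ℕ} (hm : 0 < m) {ζ : F} (hζ : IsPrimitiveRoot ζ (2 * m))
    {s : Finset ℤ} (hs : ∀ i ∉ s, gradedPiece F h i = ⊥) :
    fixedDim e f ζ = ∑ i ∈ s, finrank F (gradedPiece F h (m * i)) := by
  have hm' : (m : ℤ) ≠ 0 := by exact_mod_cast hm.ne'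
  -- Since `|m * i| ≥ |i|`, one finite index set serves every `m`, which makes the sums for `m` and
  -- `m'` comparable term by term.
  have hbot (i : ℤ) (hi : i ∉ s) : gradedPiece F h (m * i) = ⊥ := by
    have h1 : finrank F (gradedPiece F h (m * i)) ≤ finrank F (gradedPiece F h i) := by
      apply hp.finrank_gradedPiece_le
      have h2 : (1 : ℤ) ≤ m := by exact_mod_cast hm
      rcases le_total 0 i with h | h
      · exact Or.inl ⟨h, by nlinarith⟩
      · exact Or.inr ⟨by nlinarith, h⟩
    rw [hs i hi, finrank_bot, Nat.le_zero, Submodule.finrank_eq_zero] at h1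
    exact h1
  have hsup : ⨆ i : ℤ, gradedPiece F h (m * i) = ⨆ i : s, gradedPiece F h (m * i) := by
    refine le_antisymm (iSup_le fun i ↦ ?_) (iSup_le fun i ↦
      le_iSup (fun i : ℤ ↦ gradedPiece F h (m * i)) i)
    by_cases hi : i ∈ s
    · exact le_iSup (fun i : s ↦ gradedPiece F h (m * i)) ⟨i, hi⟩
    · rw [hbot i hi]
      exact bot_le
  have hind : iSupIndep fun i : s ↦ gradedPiece F h (m * i) :=
    iSupIndep_gradedPiece.comp (f := fun i : s ↦ (m * i : ℤ)) fun i j hij ↦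
      Subtype.ext (mul_left_cancel₀ hm' hij)
  rw [fixedDim, hp.eqLocus_torusAd_eq_iSup_mul hm hζ, hsup, hind.finrank_iSup_eq_sum,
    Finset.sum_coe_sort s fun i ↦ finrank F (gradedPiece F h (m * i))]

lemma fixedDim_le {m m' : ℕ} (hm : 0 < m) (hm' : 0 < m') {ζ ζ' : F}
    (hζ : IsPrimitiveRoot ζ (2 * m)) (hζ' : IsPrimitiveRoot ζ' (2 * m')) (hlt : m' < m) :
    fixedDim e f ζ ≤ fixedDim e f ζ' := by
  have hfin : {j : ℤ | gradedPiece F h j ≠ ⊥}.Finite :=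
    WellFoundedGT.finite_ne_bot_of_iSupIndep iSupIndep_gradedPiece
  have hs : ∀ i ∉ hfin.toFinset, gradedPiece F h i = ⊥ := by simp
  rw [hp.fixedDim_eq_sum hm hζ hs, hp.fixedDim_eq_sum hm' hζ' hs]
  refine Finset.sum_le_sum fun i _ ↦ hp.finrank_gradedPiece_le ?_
  have h1 : (0 : ℤ) ≤ m' := Int.natCast_nonneg m'
  have h2 : (m' : ℤ) ≤ m := by exact_mod_cast hlt.le
  rcases le_total 0 i with h | h
  · exact Or.inl ⟨mul_nonneg h1 h, mul_le_mul_of_nonneg_right h2 h⟩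
  · exact Or.inr ⟨mul_le_mul_of_nonpos_right h2 h, mul_nonpos_of_nonneg_of_nonpos h1 h⟩

lemma fixedDim_lt {m m' : ℕ} (hm : 0 < m) (hm' : 0 < m') {ζ ζ' : F}
    (hζ : IsPrimitiveRoot ζ (2 * m)) (hζ' : IsPrimitiveRoot ζ' (2 * m')) (hdvd : m' ∣ m)
    (hne : m' ≠ m) (hbot : gradedPiece F h m' ≠ ⊥) : fixedDim e f ζ < fixedDim e f ζ' := by
  refine Submodule.finrank_lt_finrank_of_lt (lt_of_le_of_ne ?_ fun heq ↦ ?_)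
  · rw [hp.eqLocus_torusAd_eq_iSup hm hζ, hp.eqLocus_torusAd_eq_iSup hm' hζ']
    refine iSup_le fun j ↦ le_iSup (fun j : {j : ℤ // (m' : ℤ) ∣ j} ↦ gradedPiece F h j)
      ⟨j, (Int.natCast_dvd_natCast.mpr hdvd).trans j.2⟩
  · obtain ⟨v, hv, hv0⟩ := (Submodule.ne_bot_iff _).mp hbot
    have h1 : v ∈ LinearMap.eqLocus (torusAd e f ζ') (1 : End F L) := by
      rw [hp.eqLocus_torusAd_eq_iSup hm' hζ']
      exact le_iSup (fun j : {j : ℤ // (m' : ℤ) ∣ j} ↦ gradedPiece F h j) ⟨m', dvd_rfl⟩ hv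
    rw [← heq, hp.eqLocus_torusAd_eq_iSup hm hζ] at h1
    -- `m` does not divide its proper divisor `m'`, so independence keeps degree `m'` out of the
    -- fixed space for `m`.
    have h2 : (m' : ℤ) ∉ {j : ℤ | (m : ℤ) ∣ j} := fun hmem ↦
      hne (Nat.dvd_antisymm hdvd (Int.natCast_dvd_natCast.mp hmem))
    rw [iSup_subtype] at h1
    have h3 := (iSupIndep_gradedPiece (F := F) (h := h)).disjoint_biSup h2
    exact hv0 (Submodule.disjoint_def.mp h3 v hv h1)

end IsPrincipalSl2Triple

end PrincipalAutomorphism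

end

/-! ### Simple ideals and the bound on the Coxeter number. -/

section

open Module LieModule LieAlgebra

section Ideal

variable {F L : Type*} [Field F] [LieRing L] [LieAlgebra F L]

lemma LieIdeal.coe_toEnd_sub_pow (I : LieIdeal F L) (x : L) (μ : F) (k : ℕ) (v : I) :
    ((((toEnd F L I x - μ • 1) ^ k) v : I) : L) = ((toEnd F L L x - μ • 1) ^ k) (v : L) := by
  induction k with
  | zero => rfl
  | succ k ih =>
    rw [pow_succ', pow_succ', Module.End.mul_apply, Module.End.mul_apply, ← ih]
    rfl

lemma LieIdeal.mem_maxGenEigenspace_iff (I : LieIdeal F L) (x : L) (μ : F) (v : I) :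
    v ∈ (toEnd F L I x).maxGenEigenspace μ ↔ (v : L) ∈ (toEnd F L L x).maxGenEigenspace μ := by
  simp only [Module.End.mem_maxGenEigenspace, ← I.coe_toEnd_sub_pow, ZeroMemClass.coe_eq_zero]

variable [FiniteDimensional F L] [IsKilling F L]

/-- Every element of a Killing Lie algebra acts on an ideal as an element of that ideal. -/
lemma LieIdeal.exists_ad_eq_toEnd (I : LieIdeal F L) (x : L) :
    ∃ y : I, ad F I y = toEnd F L I x := by
  -- The Killing complement of `I` is an ideal commuting with `I`, so only the component in `I`
  -- acts.
  obtain ⟨y, hy, z, hz, rfl⟩ := Submodule.mem_sup.mp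
    (show x ∈ I.toSubmodule ⊔ (LieIdeal.killingCompl F L I).toSubmodule by
      rw [← LieSubmodule.sup_toSubmodule, I.isCompl_killingCompl.sup_eq_top]
      trivial)
  refine ⟨⟨y, hy⟩, LinearMap.ext fun v ↦ Subtype.ext ?_⟩
  have h1 : ⁅z, (v : L)⁆ = 0 := by
    have h2 : ⁅z, (v : L)⁆ ∈ I ⊓ LieIdeal.killingCompl F L I :=
      ⟨lie_mem_right F L I z v v.2, lie_mem_left F L _ z v hz⟩
    rw [I.isCompl_killingCompl.inf_eq_bot] at h2
    exact h2
  change ⁅y, (v : L)⁆ = ⁅y + z, (v : L)⁆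
  rw [add_lie, h1, add_zero]

end Ideal

namespace PrincipalAutomorphism

section Coxeter

variable {F L : Type*} [Field F] [IsAlgClosed F] [CharZero F] [LieRing L] [LieAlgebra F L]
  [FiniteDimensional F L]

lemma finrank_add_card_root_le [IsKilling F L] (H : LieSubalgebra F L) [H.IsCartanSubalgebra] :
    finrank F H + Nat.card H.root ≤ finrank F L := by
  let χ : Option H.root → H → F := fun o ↦ o.elim 0 fun α ↦ α.1
  have hne (α : H.root) : (α.1 : H → F) ≠ 0 := (Finset.mem_filter.mp α.2).2
  have hχ : Function.Injective χ := by
    rintro (_ | α) (_ | β) hab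
    · rfl
    · exact (hne β hab.symm).elim
    · exact (hne α hab).elim
    · exact congrArg some (Subtype.ext (DFunLike.coe_injective hab))
  have hind := (LieSubmodule.iSupIndep_toSubmodule.mpr
    (iSupIndep_genWeightSpace F H L)).comp hχ
  have h1 := hind.sum_finrank_le (U := ⊤) fun _ ↦ le_top
  rw [Fintype.sum_option, finrank_top] at h1
  refine le_trans (le_of_eq ?_) h1
  congr 1
  · exact congrArg (fun W : LieSubmodule F H L ↦ finrank F W) (rootSpace_zero_eq F L H).symm
  · rw [Nat.card_eq_fintype_card, Fintype.card_eq_sum_ones]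
    refine Finset.sum_congr rfl fun α _ ↦ ?_
    exact (IsKilling.finrank_rootSpace_eq_one α.1 (hne α)).symm

lemma finrank_mul_simpleCoxeterNumber_le [IsSimple F L] (H : LieSubalgebra F L)
    [H.IsCartanSubalgebra] (hH : 0 < finrank F H) :
    finrank F H * simpleCoxeterNumber F L + finrank F H ≤ finrank F L := by
  let P := IsKilling.rootSystem H
  obtain ⟨b⟩ := RootPairing.nonempty_base P
  have hb : b.support.card = finrank F H := by
    rw [← Subspace.dual_finrank_eq, Module.finrank_eq_card_basis b.toWeightBasis, Fintype.card_coe]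
  have : Nonempty H.root := (Finset.card_pos.mp (hb ▸ hH)).to_subtype.map Subtype.val
  obtain ⟨l, hl, hmem, hle⟩ := b.exists_list_card_mul_orderOf_le
  rw [hb] at hle
  -- The Coxeter number is an infimum, so a single Coxeter element bounds it from above.
  have h1 : simpleCoxeterNumber F L ≤ orderOf (l.map P.reflection).prod :=
    Nat.sInf_le ⟨H, inferInstance, _, ⟨b, l, hl, hmem, rfl⟩, rfl⟩
  have h2 := Nat.mul_le_mul_left (finrank F H) h1
  have h3 := finrank_add_card_root_le H
  omega

end Coxeter

namespace IsPrincipalSl2Triple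

variable {F L : Type*} [Field F] [IsAlgClosed F] [CharZero F] [LieRing L] [LieAlgebra F L]
  [FiniteDimensional F L] [IsKilling F L] {h e f : L} (hp : IsPrincipalSl2Triple F h e f)

include hp

lemma gradedPiece_eq_bot_of_le {n : ℕ} (hbot : gradedPiece F h n = ⊥) {j : ℤ} (hj : n ≤ |j|) :
    gradedPiece F h j = ⊥ := by
  have key (i : ℤ) (hi : n ≤ i) : gradedPiece F h i = ⊥ := by
    have := hp.finrank_gradedPiece_le (Or.inl ⟨Int.natCast_nonneg n, hi⟩)
    rwa [hbot, finrank_bot, Nat.le_zero, Submodule.finrank_eq_zero] at this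
  rcases abs_cases j with ⟨h1, h2⟩ | ⟨h1, h2⟩
  · exact key j (h1 ▸ hj)
  · have := gradedPiece_neg_eq_bot hp.iSup_gradedPiece_eq_top hp.isSl2Triple (key _ (h1 ▸ hj))
    rwa [neg_neg] at this

/-- An ideal has dimension at most the number of degrees times the dimension of its degree zero
piece. -/
lemma finrank_ideal_le {n : ℕ} (hbot : gradedPiece F h (n + 1 : ℕ) = ⊥) (I : LieIdeal F L) :
    finrank F I ≤ (2 * n + 1) * finrank F ((toEnd F L I h).maxGenEigenspace 0) := by
  let W : Finset.Icc (-n : ℤ) n → Submodule F I :=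
    fun j ↦ (toEnd F L I h).maxGenEigenspace (2 * (j : ℤ) : F)
  have htop : ⨆ j, W j = ⊤ := by
    rw [eq_top_iff, ← (toEnd F L I h).iSup_maxGenEigenspace_eq_top]
    refine iSup_le fun μ v hv ↦ ?_
    by_cases hv0 : v = 0
    · rw [hv0]
      exact zero_mem _
    have h1 := (I.mem_maxGenEigenspace_iff h μ v).mp hv
    have h2 : (v : L) ≠ 0 := by simpa using hv0
    obtain ⟨j, rfl⟩ := hp.isSl2Triple.exists_two_mul_of_maxGenEigenspace_ne_bot L
      hp.finrank_maxGenEigenspace_one ((Submodule.ne_bot_iff _).mpr ⟨v, h1, h2⟩)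
    have h3 : |j| ≤ n := by
      by_contra! hcon
      rw [← hp.gradedPiece_eq_maxGenEigenspace,
        hp.gradedPiece_eq_bot_of_le hbot (by push_cast; omega)] at h1
      exact h2 h1
    exact le_iSup W ⟨j, Finset.mem_Icc.mpr (abs_le.mp h3)⟩ hv
  have hind : iSupIndep W :=
    (toEnd F L I h).independent_maxGenEigenspace.comp fun i j hij ↦
      Subtype.ext (Int.cast_injective (mul_left_cancel₀ two_ne_zero hij))
  rw [← finrank_top, ← htop, hind.finrank_iSup_eq_sum]
  refine (Finset.sum_le_card_nsmul _ _ (finrank F ((toEnd F L I h).maxGenEigenspace 0))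
    fun j _ ↦ ?_).trans (le_of_eq ?_)
  · have := hp.isSl2Triple.finrank_maxGenEigenspace_two_mul_le I (F := F) (i := 0) (j := j)
      ((le_total 0 (j : ℤ)).imp (fun h ↦ ⟨le_rfl, h⟩) fun h ↦ ⟨h, le_rfl⟩)
    rwa [Int.cast_zero, mul_zero] at this
  · rw [smul_eq_mul, Finset.card_univ, Fintype.card_coe, Int.card_Icc]
    congr 1
    omega

omit [IsAlgClosed F] in
/-- The degree zero piece of an ideal is a Cartan subalgebra of the ideal. -/
lemma exists_isCartanSubalgebra (I : LieIdeal F L) : ∃ H : LieSubalgebra F I,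
    H.IsCartanSubalgebra ∧
      finrank F H = finrank F ((toEnd F L I h).maxGenEigenspace 0) := by
  -- `y` is the component of `h` in `I`. Its Engel subalgebra is the intersection of `I` with that
  -- of `h`, hence abelian, and Engel subalgebras are self-normalizing.
  obtain ⟨y, hy⟩ := I.exists_ad_eq_toEnd h
  have hmem (v : I) : v ∈ LieSubalgebra.engel F y ↔ (v : L) ∈ LieSubalgebra.engel F h := by
    change v ∈ (ad F I y).maxGenEigenspace 0 ↔ _
    rw [hy]
    exact I.mem_maxGenEigenspace_iff h 0 v
  have := hp.isCartanSubalgebra_engel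
  have hab : IsLieAbelian (LieSubalgebra.engel F y) := ⟨fun a b ↦ by
    have := congrArg Subtype.val (trivial_lie_zero (LieSubalgebra.engel F h)
      (LieSubalgebra.engel F h) ⟨a, (hmem a).mp a.2⟩ ⟨b, (hmem b).mp b.2⟩)
    exact Subtype.ext (Subtype.ext this)⟩
  refine ⟨LieSubalgebra.engel F y, ⟨inferInstance, LieSubalgebra.normalizer_engel F y⟩, ?_⟩
  rw [← hy]
  rfl

/-- With `r = dim H`, the root count and the degree count give `r * h(I) + r ≤ dim I ≤ (2n + 1) *
r`, and `r > 0` cancels. -/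
lemma simpleCoxeterNumber_le {n : ℕ} (hbot : gradedPiece F h (n + 1 : ℕ) = ⊥) (I : LieIdeal F L)
    [IsSimple F I] : simpleCoxeterNumber F I ≤ 2 * n := by
  obtain ⟨H, hH, hdim⟩ := hp.exists_isCartanSubalgebra I
  have h1 := hp.finrank_ideal_le hbot I
  rw [← hdim] at h1
  have h2 : 0 < finrank F I := by
    have : Nontrivial I := not_subsingleton_iff_nontrivial.mp fun _ ↦
      IsSimple.non_abelian F (L := I) ⟨fun _ _ ↦ Subsingleton.elim _ _⟩
    exact finrank_pos
  have h3 : 0 < finrank F H := Nat.pos_of_ne_zero fun h0 ↦ by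
    rw [h0, mul_zero] at h1
    omega
  have h4 := finrank_mul_simpleCoxeterNumber_le H h3
  refine Nat.le_of_mul_le_mul_left ?_ h3
  linarith

lemma coxeterNumber_le {n m : ℕ} (hbot : gradedPiece F h (n + 1 : ℕ) = ⊥) (hm : 0 < m)
    (hnm : 2 * n ≤ m) : coxeterNumber F L ≤ m := by
  refine csSup_le ⟨1, Or.inl rfl⟩ ?_
  rintro _ (rfl | ⟨I, hI, rfl⟩)
  -- The value `1` adjoined in `coxeterNumber`.
  · exact hm
  · exact (hp.simpleCoxeterNumber_le hbot I).trans hnm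

end IsPrincipalSl2Triple

end PrincipalAutomorphism

end

theorem proposition2p2 {F : Type*} [Field F] [IsAlgClosed F] [CharZero F]
    {L : Type*} [LieRing L] [LieAlgebra F L] [FiniteDimensional F L]
    [LieAlgebra.IsSemisimple F L]
    {h e f : L} (hprin : PrincipalAutomorphism.IsPrincipalSl2Triple F h e f)
    {m m' : ℕ} (hm : 0 < m) (hm' : 0 < m')
    {ζ ζ' : F} (hζ : IsPrimitiveRoot ζ (2 * m)) (hζ' : IsPrimitiveRoot ζ' (2 * m')) :
    (m' < m → PrincipalAutomorphism.fixedDim e f ζ' ≥ PrincipalAutomorphism.fixedDim e f ζ) ∧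
    (m' ∣ m → m' ≠ m → m < PrincipalAutomorphism.coxeterNumber F L →
      PrincipalAutomorphism.fixedDim e f ζ' > PrincipalAutomorphism.fixedDim e f ζ) := by
  refine ⟨hprin.fixedDim_le hm hm' hζ hζ', fun hdvd hne hlt ↦
    hprin.fixedDim_lt hm hm' hζ hζ' hdvd hne fun hbot ↦ hlt.not_ge ?_⟩
  -- An empty degree `m' = n + 1` bounds the Coxeter numbers by `2n`, and a proper multiple `m` of
  -- `m'` is at least `2n + 2`.
  obtain ⟨n, rfl⟩ := Nat.exists_eq_add_one_of_ne_zero hm'.ne'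
  refine hprin.coxeterNumber_le hbot hm ?_
  obtain ⟨k, rfl⟩ := hdvd
  have hk : 2 ≤ k := by
    rcases k with _ | _ | k
    · simp at hm
    · simp at hne
    · omega
  nlinarith
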